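/- Let $\mathfrak g=\mathfrak g_{\bar 0}\oplus\mathfrak g_{\bar 1}$ be one of the complex Lie superalgebras $\mathfrak{gl}(m|n)$, or a finite-dimensional contragredient Lie superalgebra with indecomposable Cartan matrix, that is, $\mathfrak{sl}(m|n)$ ($m\ne n$), $\mathfrak{gl}(n|n)$, $\mathfrak{osp}(m|2n)$, $D(2,1,\alpha)$, $F(4)$ or $G(3)$. Let $\mathfrak h\subset\mathfrak g_{\bar 0}$ be a Cartan subalgebra and $(\cdot,\cdot)$ a nondegenerate even supersymmetric invariant bilinear form. For a finite-dimensional $\mathfrak g$-module $M$ with weight spaces $M^\mu$, $\mu\in\mathfrak h^*$, let $\operatorname{sch}M=\sum_\mu(\dim M^\mu_{\bar 0}-\dim M^\mu_{\bar 1})e^\mu$; let $\mathcal J_{\mathfrak g}$ be the ring of all supercharacters of finite-dimensional modules, and view $f=\sum c_\mu e^\mu\in\mathcal J_{\mathfrak g}$ as the function $f(t)=\sum c_\mu e^{\mu(t)}$ on $\mathfrak h$. Let $B=\{\beta_1,\dots,\beta_k\}$ be a set of isotropic odd roots with $(\beta_i,\beta_j)=0$ for all $i,j$ and $\beta_i\ne\pm\beta_j$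 for $i\ne j$, and let $x=x_{\beta_1}+\dots+x_{\beta_k}$ with $0\ne x_{\beta_i}\in\mathfrak g_{\beta_i}$. Then $[x,x]=0$. Put $\mathfrak g^x=\{a:[x,a]=0\}$, $\mathfrak g_x=\mathfrak g^x/[x,\mathfrak g]$, $\mathfrak h^x=\mathfrak h\cap\mathfrak g^x$, let $\mathfrak h_x$ be the image of $\mathfrak h^x$ in $\mathfrak g_x$, and for a $\mathfrak g$-module $M$ let $M_x=\operatorname{Ker}_M x/xM$, a $\mathfrak g_x$-module. There is a unique ring homomorphism $ds_x:\mathcal J_{\mathfrak g}\to\mathcal J_{\mathfrak g_x}$ with $ds_x(\operatorname{sch}M)=\operatorname{sch}M_x$ for every finite-dimensional $M$ (supercharacters of $\mathfrak g_x$-modules being taken with respect to $\mathfrak h_x$), and for every $f\in\mathcal J_{\mathfrak g}$: 1. $ds_x(f)=f|_{\mathfrak h_x}$, where $\mathfrak g_x$ is embedded in $\mathfrak g^x$ as any graded subalgebra with $\mathfrak g^x=[x,\mathfrak g]\oplus\mathfrak g_x$ and $\mathfrak h_x$ is identified with $\mathfrak h\cap\mathfrak g_x$. 2. Write $x_i=e^{\varepsilon_i}$,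 $y_j=e^{\delta_j}$ for functionals $\varepsilon_i,\delta_j\in\mathfrak h^*$ and express $f$ in these variables. If $B=\{\varepsilon_1-\delta_1\}$, then $ds_x(f)=f|_{x_1=y_1}$. If $B=\{\frac12(\varepsilon_1+\varepsilon_2+\varepsilon_3-\delta_1)\}$ (as for $F(4)$, with $x_i=e^{\varepsilon_i/2}$, $y_1=e^{\delta_1/2}$), then $ds_x(f)=f|_{y_1=x_1x_2x_3}$. If $B=\{\varepsilon_1-\varepsilon_2-\varepsilon_3\}$ (as for $D(2,1,\alpha)$), then $ds_x(f)=f|_{x_1=x_2x_3}$. 3. If $\beta_i=a_i\varepsilon_{r_i}-b_i\delta_{s_i}$ with $a_i,b_i\in\{\pm1\}$ for $i=1,\dots,k$, then $ds_x(f)$ is obtained from $f$ by substituting $x_{r_i}^{a_i}=y_{s_i}^{b_i}$, $i=1,\dots,k$. 4. $ds_x(f)=f|_{\beta_1=\dots=\beta_k=0}$; here $\{t\in\mathfrak h:\beta_1(t)=\dots=\beta_k(t)=0\}=\mathfrak h^x$. In 2–4 the right-hand sides are functions on $\mathfrak h^x$, and the equality means that they are the pull-back of the function $ds_x(f)$ on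 $\mathfrak h_x$ along the projection $\mathfrak h^x\to\mathfrak h_x$. -/

import Mathlib

noncomputable section

namespace SuperLie

/-! ## Lie superalgebras and their modules over the complex numbers -/

/-- The sign `(-1)^(i j)` attached to two parities. -/
def superSign (i j : ZMod 2) : ℂ := if i = 1 ∧ j = 1 then -1 else 1

/-- A complex vector space with a `ℤ/2`-grading. -/
class SuperSpace (V : Type*) [AddCommGroup V] [Module ℂ V] where
  part : ZMod 2 → Submodule ℂ V
  isCompl_part : IsCompl (part 0) (part 1)

/-- A Lie superalgebra over `ℂ`. -/
class LieSuperalgebra (L : Type*) [AddCommGroup L] [Module ℂ L] extends SuperSpace L where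
  bracket : L →ₗ[ℂ] L →ₗ[ℂ] L
  bracket_mem : ∀ {i j : ZMod 2} {a b : L}, a ∈ part i → b ∈ part j → bracket a b ∈ part (i + j)
  bracket_skew : ∀ {i j : ZMod 2} {a b : L}, a ∈ part i → b ∈ part j →
    bracket a b = -(superSign i j • bracket b a)
  bracket_jacobi : ∀ {i j : ZMod 2} {a b : L} (c : L), a ∈ part i → b ∈ part j →
    bracket a (bracket b c) = bracket (bracket a b) c + superSign i j • bracket b (bracket a c)

open SuperSpace LieSuperalgebra

/-- A module over a Lie superalgebra; the grading is part of the data. -/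
class LieSupermodule (L M : Type*) [AddCommGroup L] [Module ℂ L] [LieSuperalgebra L]
    [AddCommGroup M] [Module ℂ M] [SuperSpace M] where
  act : L →ₗ[ℂ] Module.End ℂ M
  act_mem : ∀ {i j : ZMod 2} {a : L} {m : M}, a ∈ part i → m ∈ part j → act a m ∈ part (i + j)
  act_bracket : ∀ {i j : ZMod 2} {a b : L} (m : M), a ∈ part i → b ∈ part j →
    act (bracket a b) m = act a (act b m) - superSign i j • act b (act a m)

open LieSupermodule

/-- The adjoint module. -/
instance adjointModule (L : Type*) [AddCommGroup L] [Module ℂ L] [LieSuperalgebra L] :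
    LieSupermodule L L where
  act := bracket
  act_mem := bracket_mem
  act_bracket := fun m ha hb => by rw [bracket_jacobi m ha hb]; simp

/-- The odd part of a Lie superalgebra. -/
abbrev OddPart (L : Type*) [AddCommGroup L] [Module ℂ L] [LieSuperalgebra L] : Type _ :=
  (part 1 : Submodule ℂ L)

section Graded

variable {V : Type*} [AddCommGroup V] [Module ℂ V] [SuperSpace V]

theorem exists_decomp (v : V) :
    ∃ v0 ∈ part (V := V) 0, ∃ v1 ∈ part (V := V) 1, v0 + v1 = v := by
  have h : v ∈ part (V := V) 0 ⊔ part (V := V) 1 := by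
    rw [isCompl_part.sup_eq_top]; trivial
  exact Submodule.mem_sup.mp h

theorem eq_zero_of_add_eq_zero {a b : V} (ha : a ∈ part (V := V) 0) (hb : b ∈ part (V := V) 1)
    (h : a + b = 0) : a = 0 ∧ b = 0 := by
  have hab : a = -b := eq_neg_of_add_eq_zero_left h
  have h0 : a = 0 := by
    have : a ∈ part (V := V) 0 ⊓ part (V := V) 1 :=
      ⟨ha, hab ▸ (part (V := V) 1).neg_mem hb⟩
    rwa [isCompl_part.inf_eq_bot, Submodule.mem_bot] at this
  refine ⟨h0, ?_⟩
  rw [h0, zero_add] at h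
  exact h

end Graded

/-! ## The Duflo–Serganova construction -/

section DS

variable {L : Type*} [AddCommGroup L] [Module ℂ L] [LieSuperalgebra L] (x : OddPart L)
  (M : Type*) [AddCommGroup M] [Module ℂ M] [SuperSpace M] [LieSupermodule L M]

/-- The kernel of the odd element `x` in the module `M`. -/
def kerx : Submodule ℂ M := LinearMap.ker (act (x : L) : Module.End ℂ M)

/-- The image `x M`. -/
def imx : Submodule ℂ M := LinearMap.range (act (x : L) : Module.End ℂ M)

/-- `M_x = Ker x / x M`. The quotient is by `x M ∩ Ker x`, which is `x M` when `[x, x] = 0`. -/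
def DSMod : Type _ := kerx x M ⧸ (imx x M).submoduleOf (kerx x M)

instance : AddCommGroup (DSMod x M) :=
  inferInstanceAs (AddCommGroup (kerx x M ⧸ (imx x M).submoduleOf (kerx x M)))

instance : Module ℂ (DSMod x M) :=
  inferInstanceAs (Module ℂ (kerx x M ⧸ (imx x M).submoduleOf (kerx x M)))

instance [FiniteDimensional ℂ M] : FiniteDimensional ℂ (DSMod x M) :=
  inferInstanceAs (FiniteDimensional ℂ (kerx x M ⧸ (imx x M).submoduleOf (kerx x M)))

/-- The class in `M_x` of an element of `Ker x`. -/
def DSMod.mk : kerx x M →ₗ[ℂ] DSMod x M := ((imx x M).submoduleOf (kerx x M)).mkQ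

/-- `g_x = g^x / [x, g]`, the same construction for the adjoint module. -/
abbrev DSAlg : Type _ := DSMod x L

variable {x M}

theorem mem_kerx {m : M} : m ∈ kerx x M ↔ act (x : L) m = 0 := LinearMap.mem_ker

theorem mem_imx {m : M} : m ∈ imx x M ↔ ∃ w : M, act (x : L) w = m := LinearMap.mem_range

theorem DSMod.mk_surjective : Function.Surjective (DSMod.mk x M) := Submodule.mkQ_surjective _

theorem DSMod.mk_eq_zero {m : kerx x M} : DSMod.mk x M m = 0 ↔ (m : M) ∈ imx x M := by
  exact Submodule.Quotient.mk_eq_zero ((imx x M).submoduleOf (kerx x M))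

theorem act_odd_mem0 {m : M} (hm : m ∈ part (V := M) 0) :
    act (x : L) m ∈ part (V := M) 1 := by
  have := act_mem (L := L) x.2 hm
  simpa using this

theorem act_odd_mem1 {m : M} (hm : m ∈ part (V := M) 1) :
    act (x : L) m ∈ part (V := M) 0 := by
  have := act_mem (L := L) x.2 hm
  rwa [show (1 + 1 : ZMod 2) = 0 from rfl] at this

theorem kerx_graded {a b : M} (ha : a ∈ part (V := M) 0) (hb : b ∈ part (V := M) 1)
    (h : a + b ∈ kerx x M) : a ∈ kerx x M ∧ b ∈ kerx x M := by
  rw [mem_kerx, map_add, add_comm] at h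
  have := eq_zero_of_add_eq_zero (act_odd_mem1 hb) (act_odd_mem0 ha) h
  exact ⟨mem_kerx.2 this.2, mem_kerx.2 this.1⟩

theorem imx_graded {a b : M} (ha : a ∈ part (V := M) 0) (hb : b ∈ part (V := M) 1)
    (h : a + b ∈ imx x M) : a ∈ imx x M ∧ b ∈ imx x M := by
  obtain ⟨w, hw⟩ := mem_imx.1 h
  obtain ⟨w0, h0, w1, h1, rfl⟩ := exists_decomp w
  rw [map_add] at hw
  have key := eq_zero_of_add_eq_zero
    ((part (V := M) 0).sub_mem (act_odd_mem1 (x := x) h1) ha)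
    ((part (V := M) 1).sub_mem (act_odd_mem0 (x := x) h0) hb) (by
      rw [sub_add_sub_comm, sub_eq_zero, ← hw, add_comm])
  exact ⟨mem_imx.2 ⟨w1, sub_eq_zero.1 key.1⟩, mem_imx.2 ⟨w0, sub_eq_zero.1 key.2⟩⟩

instance : SuperSpace (DSMod x M) where
  part := fun i => ((part (V := M) i).comap (kerx x M).subtype).map (DSMod.mk x M)
  isCompl_part := by
    constructor
    · rw [Submodule.disjoint_def]
      rintro _ ⟨a, ha, rfl⟩ ⟨b, hb, hab⟩
      have h0 : DSMod.mk x M (a - b) = 0 := by rw [map_sub, hab, sub_self]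
      rw [DSMod.mk_eq_zero, Submodule.coe_sub, sub_eq_add_neg] at h0
      exact DSMod.mk_eq_zero.2 (imx_graded ha ((part (V := M) 1).neg_mem hb) h0).1
    · rw [codisjoint_iff, eq_top_iff]
      rintro v -
      obtain ⟨⟨m, hm⟩, rfl⟩ := DSMod.mk_surjective v
      obtain ⟨a, ha, b, hb, rfl⟩ := exists_decomp m
      obtain ⟨ka, kb⟩ := kerx_graded ha hb hm
      refine Submodule.mem_sup.2 ⟨DSMod.mk x M ⟨a, ka⟩, ⟨⟨a, ka⟩, ha, rfl⟩,
        DSMod.mk x M ⟨b, kb⟩, ⟨⟨b, kb⟩, hb, rfl⟩, ?_⟩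
      rw [← map_add]
      rfl

theorem DSMod.mem_part {i : ZMod 2} {v : DSMod x M} (hv : v ∈ part (V := DSMod x M) i) :
    ∃ m : kerx x M, (m : M) ∈ part (V := M) i ∧ DSMod.mk x M m = v := hv

theorem DSMod.mk_mem_part {i : ZMod 2} {m : kerx x M} (hm : (m : M) ∈ part (V := M) i) :
    DSMod.mk x M m ∈ part (V := DSMod x M) i := ⟨m, hm, rfl⟩

/-- Moving `x` past a homogeneous element of `g`. -/
theorem act_x_act {i : ZMod 2} {a : L} (ha : a ∈ part (V := L) i) (m : M) :
    act (x : L) (act a m) =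
      act (bracket (x : L) a) m + superSign 1 i • act a (act (x : L) m) := by
  rw [act_bracket m x.2 ha]
  abel

theorem act_mem_kerx {a : L} (ha : a ∈ kerx x L) {m : M} (hm : m ∈ kerx x M) :
    act a m ∈ kerx x M := by
  obtain ⟨a0, h0, a1, h1, rfl⟩ := exists_decomp a
  obtain ⟨k0, k1⟩ := kerx_graded h0 h1 ha
  have k0' : bracket (x : L) a0 = 0 := mem_kerx.1 k0
  have k1' : bracket (x : L) a1 = 0 := mem_kerx.1 k1
  rw [mem_kerx] at hm ⊢
  rw [map_add, LinearMap.add_apply, map_add, act_x_act h0, act_x_act h1, hm, k0', k1']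
  simp

theorem act_mem_imx_right {a : L} (ha : a ∈ kerx x L) {m : M} (hm : m ∈ imx x M) :
    act a m ∈ imx x M := by
  obtain ⟨a0, h0, a1, h1, rfl⟩ := exists_decomp a
  obtain ⟨k0, k1⟩ := kerx_graded h0 h1 ha
  have k0' : bracket (x : L) a0 = 0 := mem_kerx.1 k0
  have k1' : bracket (x : L) a1 = 0 := mem_kerx.1 k1
  obtain ⟨w, rfl⟩ := mem_imx.1 hm
  refine mem_imx.2 ⟨act a0 w - act a1 w, ?_⟩
  rw [map_sub, act_x_act h0, act_x_act h1, k0', k1']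
  simp [superSign]

theorem act_mem_imx_left {a : L} (ha : a ∈ imx x L) {m : M} (hm : m ∈ kerx x M) :
    act a m ∈ imx x M := by
  obtain ⟨w, rfl⟩ := mem_imx.1 ha
  obtain ⟨w0, h0, w1, h1, rfl⟩ := exists_decomp w
  rw [mem_kerx] at hm
  refine mem_imx.2 ⟨act w0 m + act w1 m, ?_⟩
  rw [map_add, act_x_act h0, act_x_act h1, hm]
  rw [map_add, map_add, LinearMap.add_apply]
  simp only [map_zero, smul_zero, add_zero]
  rfl

variable (x M)

/-- The action of `g^x` on `Ker x`, followed by the projection to `M_x`. -/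
def DSMod.preAct : kerx x L →ₗ[ℂ] kerx x M →ₗ[ℂ] DSMod x M :=
  LinearMap.mk₂ ℂ (fun a m => DSMod.mk x M ⟨act (a : L) (m : M), act_mem_kerx a.2 m.2⟩)
    (fun a b m => by rw [← map_add]; congr 1; ext; simp)
    (fun c a m => by rw [← map_smul]; congr 1; ext; simp)
    (fun a m n => by rw [← map_add]; congr 1; ext; simp)
    (fun c a m => by rw [← map_smul]; congr 1; ext; simp)

/-- The induced action of `g_x` on `M_x`. -/
def DSMod.dsAct : DSAlg x →ₗ[ℂ] DSMod x M →ₗ[ℂ] DSMod x M :=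
  LinearMap.liftQ₂ ((imx x L).submoduleOf (kerx x L)) ((imx x M).submoduleOf (kerx x M))
    (DSMod.preAct x M)
    (fun _ ha => LinearMap.mem_ker.2 (LinearMap.ext fun m =>
      DSMod.mk_eq_zero.2 (act_mem_imx_left ha m.2)))
    (fun _ hm => LinearMap.mem_ker.2 (LinearMap.ext fun a =>
      DSMod.mk_eq_zero.2 (act_mem_imx_right a.2 hm)))

variable {x M}

theorem DSMod.dsAct_mk (a : kerx x L) (m : kerx x M) :
    DSMod.dsAct x M (DSMod.mk x L a) (DSMod.mk x M m) =
      DSMod.mk x M ⟨act (a : L) (m : M), act_mem_kerx a.2 m.2⟩ := rfl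

/-- The Lie superalgebra structure of `g_x`. -/
instance : LieSuperalgebra (DSAlg x) where
  bracket := DSMod.dsAct x L
  bracket_mem := by
    intro i j a b ha hb
    obtain ⟨a, ka, rfl⟩ := DSMod.mem_part ha
    obtain ⟨b, kb, rfl⟩ := DSMod.mem_part hb
    rw [DSMod.dsAct_mk]
    exact DSMod.mk_mem_part (bracket_mem ka kb)
  bracket_skew := by
    intro i j a b ha hb
    obtain ⟨a, ka, rfl⟩ := DSMod.mem_part ha
    obtain ⟨b, kb, rfl⟩ := DSMod.mem_part hb
    rw [DSMod.dsAct_mk, DSMod.dsAct_mk, ← map_smul, ← map_neg]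
    congr 1
    ext
    exact bracket_skew ka kb
  bracket_jacobi := by
    intro i j a b c ha hb
    obtain ⟨a, ka, rfl⟩ := DSMod.mem_part ha
    obtain ⟨b, kb, rfl⟩ := DSMod.mem_part hb
    obtain ⟨c, rfl⟩ := DSMod.mk_surjective c
    simp only [DSMod.dsAct_mk]
    rw [← map_smul, ← map_add]
    congr 1
    ext
    exact bracket_jacobi (c : L) ka kb

/-- The `g_x`-module structure of `M_x`. -/
instance : LieSupermodule (DSAlg x) (DSMod x M) where
  act := DSMod.dsAct x M
  act_mem := by
    intro i j a m ha hm
    obtain ⟨a, ka, rfl⟩ := DSMod.mem_part ha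
    obtain ⟨m, km, rfl⟩ := DSMod.mem_part hm
    rw [DSMod.dsAct_mk]
    exact DSMod.mk_mem_part (act_mem ka km)
  act_bracket := by
    intro i j a b m ha hb
    obtain ⟨a, ka, rfl⟩ := DSMod.mem_part ha
    obtain ⟨b, kb, rfl⟩ := DSMod.mem_part hb
    obtain ⟨m, rfl⟩ := DSMod.mk_surjective m
    change DSMod.dsAct x M (DSMod.dsAct x L _ _) _ = _
    simp only [DSMod.dsAct_mk]
    rw [← map_smul, ← map_sub]
    congr 1
    ext
    exact act_bracket (m : M) ka kb

end DS

/-! ## Cartan subalgebras, supercharacters and the supercharacter ring -/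

/-- An even abelian subalgebra. -/
structure EvenAbelian (L : Type*) [AddCommGroup L] [Module ℂ L] [LieSuperalgebra L] where
  carrier : Submodule ℂ L
  le_even : carrier ≤ part 0
  abelian : ∀ a ∈ carrier, ∀ b ∈ carrier, bracket a b = 0

section Weights

variable {L : Type*} [AddCommGroup L] [Module ℂ L] [LieSuperalgebra L] (H : EvenAbelian L)

/-- The space of linear functionals on `h`. -/
abbrev EvenAbelian.Weight : Type _ := Module.Dual ℂ H.carrier

/-- The root space `g_α`. -/
def rootSpace (α : H.Weight) : Submodule ℂ L where
  carrier := {a | ∀ t : H.carrier, bracket (t : L) a = α t • a}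
  add_mem' := fun ha hb t => by rw [map_add, ha t, hb t, smul_add]
  zero_mem' := fun t => by simp
  smul_mem' := fun c a ha t => by rw [map_smul, ha t, smul_comm]

/-- `h` is a Cartan subalgebra with a root space decomposition
`g = h ⊕ ⨁_α g_α`. -/
structure EvenAbelian.IsCartan : Prop where
  rootSpace_zero : rootSpace H 0 = H.carrier
  iSup_rootSpace : ⨆ α : H.Weight, rootSpace H α = ⊤

/-- The odd roots. -/
def oddRoots : Set H.Weight :=
  {β | β ≠ 0 ∧ rootSpace H β ≠ ⊥ ∧ rootSpace H β ≤ part 1}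

variable (M : Type*) [AddCommGroup M] [Module ℂ M] [SuperSpace M] [LieSupermodule L M]

/-- The weight space `M^μ`, taken as a simultaneous generalized eigenspace so that every
finite-dimensional module is the sum of its weight spaces; when `h` acts diagonalizably this is
the space of `m` with `t m = μ(t) m` for all `t` in `h`. -/
def weightSpace (μ : H.Weight) : Submodule ℂ M :=
  ⨅ t : H.carrier, (act (t : L) : Module.End ℂ M).maxGenEigenspace (μ t)

/-- `dim M_0^μ - dim M_1^μ`. -/
def superMult (μ : H.Weight) : ℤ :=
  (Module.finrank ℂ ↥(weightSpace H M μ ⊓ part 0) : ℤ) -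
    (Module.finrank ℂ ↥(weightSpace H M μ ⊓ part 1) : ℤ)

theorem act_commute (s t : H.carrier) :
    Commute (act (s : L) : Module.End ℂ M) (act (t : L) : Module.End ℂ M) := by
  ext m
  have h := act_bracket (L := L) m (H.le_even s.2) (H.le_even t.2)
  rw [H.abelian s s.2 t t.2] at h
  simp only [map_zero, LinearMap.zero_apply, superSign] at h
  simp only [Module.End.mul_apply]
  simpa using (sub_eq_zero.1 (by simpa using h.symm))

theorem superMult_support_finite [FiniteDimensional ℂ M] :
    (Function.support (superMult H M)).Finite := by
  have hind := Module.End.independent_iInf_maxGenEigenspace_of_forall_mapsTo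
    (fun t : H.carrier => (act (t : L) : Module.End ℂ M))
    (fun s t φ => Module.End.mapsTo_maxGenEigenspace_of_comm (act_commute H M t s) φ)
  have hfin := WellFoundedGT.finite_ne_bot_of_iSupIndep hind
  refine (hfin.preimage (f := fun μ : H.Weight => (μ : H.carrier → ℂ))
    DFunLike.coe_injective.injOn).subset ?_
  intro μ hμ hbot
  apply hμ
  have hb : weightSpace H M μ = ⊥ := hbot
  rw [superMult, hb, bot_inf_eq, bot_inf_eq, sub_self]

/-- The supercharacter `sch M = ∑_μ (dim M_0^μ - dim M_1^μ) e^μ`, in the group ring of `h*`. -/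
def sch [FiniteDimensional ℂ M] : AddMonoidAlgebra ℤ H.Weight :=
  AddMonoidAlgebra.ofCoeff (Finsupp.ofSupportFinite (superMult H M) (superMult_support_finite H M))

end Weights

universe u v

/-- The supercharacter ring `J_g`: the ring generated by the supercharacters of the
finite-dimensional modules. (As `sch M + sch N = sch (M ⊕ N)`, `-sch M = sch (Π M)` and
`sch M * sch N = sch (M ⊗ N)`, each element is itself a supercharacter.) -/
def superCharRing {L : Type u} [AddCommGroup L] [Module ℂ L] [LieSuperalgebra L]
    (H : EvenAbelian L) : Subring (AddMonoidAlgebra ℤ H.Weight) :=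
  Subring.closure {f | ∃ (M : Type v) (_ : AddCommGroup M) (_ : Module ℂ M)
    (_ : FiniteDimensional ℂ M) (_ : SuperSpace M) (_ : LieSupermodule L M), sch H M = f}

/-- The class `[M]` in the supercharacter ring. -/
def schClass {L : Type u} [AddCommGroup L] [Module ℂ L] [LieSuperalgebra L]
    (H : EvenAbelian L) (M : Type v) [AddCommGroup M] [Module ℂ M] [FiniteDimensional ℂ M]
    [SuperSpace M] [LieSupermodule L M] : superCharRing.{u, v} H :=
  ⟨sch H M, Subring.subset_closure ⟨M, _, _, _, _, _, rfl⟩⟩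

/-! ## The subalgebra `h_x` and the map `ds_x` -/

section Cartanx

variable {L : Type u} [AddCommGroup L] [Module ℂ L] [LieSuperalgebra L] (H : EvenAbelian L)
  (x : OddPart L)

/-- `h^x = h ∩ g^x`, the elements of `h` that commute with `x`. -/
def hCent : Submodule ℂ H.carrier := (kerx x L).comap H.carrier.subtype

/-- The map `h^x → g_x = g^x / [x, g]`. -/
def hCentToDS : hCent H x →ₗ[ℂ] DSAlg x where
  toFun := fun t => DSMod.mk x L ⟨((t : H.carrier) : L), t.2⟩
  map_add' := fun s t => by rw [← map_add]; rfl
  map_smul' := fun c t => by rw [RingHom.id_apply, ← map_smul]; rfl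

/-- `h_x`, the image of `h^x` in `g_x`. -/
def EvenAbelian.ds : EvenAbelian (DSAlg x) where
  carrier := LinearMap.range (hCentToDS H x)
  le_even := by
    rintro _ ⟨t, rfl⟩
    exact DSMod.mk_mem_part (H.le_even t.1.2)
  abelian := by
    rintro _ ⟨s, rfl⟩ _ ⟨t, rfl⟩
    change DSMod.mk x L ⟨bracket ((s : H.carrier) : L) ((t : H.carrier) : L), _⟩ = 0
    rw [DSMod.mk_eq_zero]
    change bracket ((s : H.carrier) : L) ((t : H.carrier) : L) ∈ _
    rw [H.abelian _ s.1.2 _ t.1.2]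
    exact Submodule.zero_mem _

/-- The projection `h^x → h_x` along `[x, g] ∩ h`. -/
def toHx : hCent H x →ₗ[ℂ] (H.ds x).carrier := (hCentToDS H x).rangeRestrict

/-- `ds` is the map `[M] ↦ [M_x]`. -/
def IsDS (ds : superCharRing.{u, v} H →+* superCharRing.{u, v} (H.ds x)) : Prop :=
  ∀ (M : Type v) [AddCommGroup M] [Module ℂ M] [FiniteDimensional ℂ M] [SuperSpace M]
    [LieSupermodule L M], ds (schClass H M) = schClass (H.ds x) (DSMod x M)

/-- `k` is a copy of `g_x` inside `g^x`: a graded subalgebra with `g^x = [x, g] ⊕ k`. -/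
structure IsEmbeddedDS (k : Submodule ℂ L) : Prop where
  le_cent : k ≤ kerx x L
  bracket_mem : ∀ a ∈ k, ∀ b ∈ k, bracket a b ∈ k
  graded : k = (k ⊓ part 0) ⊔ (k ⊓ part 1)
  disjoint : Disjoint (imx x L) k
  sup_eq : imx x L ⊔ k = kerx x L

variable {x}

/-- For an embedded copy `k` of `g_x`, the subspace `h ∩ k` lies in `h^x`. -/
theorem IsEmbeddedDS.le_hCent {k : Submodule ℂ L} (hk : IsEmbeddedDS x k) :
    k.comap H.carrier.subtype ≤ hCent H x := fun _ ht => hk.le_cent ht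

/-- The identification of `h ∩ k` with the Cartan subalgebra `h_x` of `g_x`. -/
def embeddedToHx {k : Submodule ℂ L} (hk : IsEmbeddedDS x k) :
    ↥(k.comap H.carrier.subtype) →ₗ[ℂ] (H.ds x).carrier :=
  (toHx H x).comp (Submodule.inclusion (hk.le_hCent H))

end Cartanx

/-! ## Elements of the group ring as functions; restriction and substitution -/

/-- The function `t ↦ ∑ c_μ exp (μ(t))` attached to `∑ c_μ e^μ`. -/
def evalAt {V : Type*} [AddCommGroup V] [Module ℂ V]
    (f : AddMonoidAlgebra ℤ (Module.Dual ℂ V)) (t : V) : ℂ :=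
  f.coeff.sum fun μ c => (c : ℂ) * Complex.exp (μ t)

/-- Pull-back of exponential sums along a linear map (restriction, for an inclusion):
`e^μ ↦ e^(μ ∘ φ)`. -/
def pullbackExp {V W : Type*} [AddCommGroup V] [Module ℂ V] [AddCommGroup W] [Module ℂ W]
    (φ : V →ₗ[ℂ] W) :
    AddMonoidAlgebra ℤ (Module.Dual ℂ W) →+* AddMonoidAlgebra ℤ (Module.Dual ℂ V) :=
  AddMonoidAlgebra.mapDomainRingHom ℤ φ.dualMap.toAddMonoidHom

/-- Expressions in variables `z_i` are integral combinations of monomials `∏ z_i^(c i)` with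
complex exponents. This is the ring homomorphism with `z_i^c ↦ e^(c w_i)`. Taking for `w` functionals
on `h`, it puts `z_i = e^(w i)`; taking for `w` exponent vectors, it substitutes the monomial
with exponent vector `w i` for `z_i`. -/
def substMonomials {ν : Type*} [Fintype ν] {W : Type*} [AddCommGroup W] [Module ℂ W]
    (w : ν → W) : AddMonoidAlgebra ℤ (ν → ℂ) →+* AddMonoidAlgebra ℤ W :=
  AddMonoidAlgebra.mapDomainRingHom ℤ (Fintype.linearCombination ℂ w).toAddMonoidHom

/-- The exponent vector of the variable `z_i`. -/
def varExp {ν : Type*} [DecidableEq ν] (i : ν) : ν → ℂ := Pi.single i 1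

/-! ## Invariant forms and isotropic roots -/

/-- A nondegenerate even supersymmetric invariant bilinear form. -/
structure InvariantForm (L : Type*) [AddCommGroup L] [Module ℂ L] [LieSuperalgebra L] where
  form : LinearMap.BilinForm ℂ L
  even : ∀ {i j : ZMod 2} {a b : L}, a ∈ part i → b ∈ part j → i ≠ j → form a b = 0
  supersymm : ∀ {i j : ZMod 2} {a b : L}, a ∈ part i → b ∈ part j →
    form a b = superSign i j * form b a
  invariant : ∀ a b c : L, form (bracket a b) c = form a (bracket b c)
  nondegenerate : form.Nondegenerate

section Roots

variable {L : Type*} [AddCommGroup L] [Module ℂ L] [LieSuperalgebra L] (Φ : InvariantForm L)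
  (H : EvenAbelian L)

/-- `t` is the element `t_α` of `h` with `(t_α, s) = α(s)` for all `s` in `h`. -/
def InvariantForm.Represents (t : H.carrier) (α : H.Weight) : Prop :=
  ∀ s : H.carrier, Φ.form (t : L) (s : L) = α s

/-- `(α, β) = 0` for the induced form `(α, β) = (t_α, t_β)` on `h*`. -/
def InvariantForm.Orthogonal (α β : H.Weight) : Prop :=
  ∃ s t : H.carrier, Φ.Represents H s α ∧ Φ.Represents H t β ∧ Φ.form (s : L) (t : L) = 0

/-- `{β_1, …, β_k}` is a set of mutually orthogonal isotropic roots with `β_i ≠ ± β_j`. -/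
structure IsIsotropicSet {k : ℕ} (β : Fin k → H.Weight) : Prop where
  odd_root : ∀ i, β i ∈ oddRoots H
  orthogonal : ∀ i j, Φ.Orthogonal H (β i) (β j)
  ne : ∀ i j, i ≠ j → β i ≠ β j ∧ β i ≠ -β j

end Roots

/-! ## The class of Lie superalgebras -/

section Class

variable {L : Type*} [AddCommGroup L] [Module ℂ L] [LieSuperalgebra L] (H : EvenAbelian L)

/-- `L` is the contragredient Lie superalgebra of the Cartan matrix `A` and the parity function
`p`, with Cartan subalgebra `h`: `h` is a minimal realization of `A`, `L` is generated by `h` and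
Chevalley generators `e_i`, `f_i`, and no nonzero ideal of `L` meets `h` trivially. -/
def IsContragredient {ι : Type} [Fintype ι] [DecidableEq ι] (A : Matrix ι ι ℂ) (p : ι → ZMod 2) :
    Prop :=
  ∃ (hh : ι → H.carrier) (α : ι → H.Weight) (e f : ι → L),
    LinearIndependent ℂ hh ∧ LinearIndependent ℂ α ∧
    Module.finrank ℂ H.carrier + A.rank = 2 * Fintype.card ι ∧
    (∀ i j, α j (hh i) = A i j) ∧
    (∀ i, e i ∈ part (p i) ∧ f i ∈ part (p i)) ∧
    (∀ i, e i ∈ rootSpace H (α i) ∧ f i ∈ rootSpace H (-α i)) ∧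
    (∀ i j, bracket (e i) (f j) = if i = j then (hh i : L) else 0) ∧
    (∀ K : Submodule ℂ L, H.carrier ≤ K → (∀ i, e i ∈ K ∧ f i ∈ K) →
      (∀ a ∈ K, ∀ b ∈ K, bracket a b ∈ K) → K = ⊤) ∧
    (∀ I : Submodule ℂ L, (∀ a : L, ∀ b ∈ I, bracket a b ∈ I) → I ⊓ H.carrier = ⊥ → I = ⊥)

/-- `A` is not, up to simultaneous reordering of rows and columns, block diagonal. -/
def IsIndecomposable {ι : Type} (A : Matrix ι ι ℂ) : Prop :=
  Nonempty ι ∧ ∀ S : Set ι, S.Nonempty → Sᶜ.Nonempty →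
    ∃ i ∈ S, ∃ j ∈ Sᶜ, A i j ≠ 0 ∨ A j i ≠ 0

/-- The parity of an index of an `(m|n) × (m|n)` matrix. -/
def idxParity {m n : ℕ} : Fin m ⊕ Fin n → ZMod 2 := Sum.elim (fun _ => 0) (fun _ => 1)

/-- `L` is `gl(m|n)`, with `h` the diagonal matrices. -/
def IsGL (m n : ℕ) : Prop :=
  ∃ φ : L ≃ₗ[ℂ] Matrix (Fin m ⊕ Fin n) (Fin m ⊕ Fin n) ℂ,
    (∀ (i : ZMod 2) (a : L), a ∈ part (V := L) i ↔
      ∀ r s, idxParity r + idxParity s ≠ i → φ a r s = 0) ∧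
    (∀ (i j : ZMod 2) (a b : L), a ∈ part (V := L) i → b ∈ part (V := L) j →
      φ (bracket a b) = φ a * φ b - superSign i j • (φ b * φ a)) ∧
    (∀ a : L, a ∈ H.carrier ↔ (φ a).IsDiag)

/-- `L` is `gl(m|n)`, or a contragredient Lie superalgebra with indecomposable invertible Cartan
matrix. Among the finite-dimensional `L` these are `gl(m|n)`, `sl(m|n)` with `m ≠ n`, `osp(m|2n)`,
`D(2,1,α)`, `F(4)`, `G(3)` and the simple Lie algebras: `gl(n|n)` is the only one of the
contragredient Lie superalgebras considered whose Cartan matrix is singular. -/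
def IsContragredientOrGL : Prop :=
  (∃ m n : ℕ, IsGL H m n) ∨
  ∃ (ι : Type) (_ : Fintype ι) (_ : DecidableEq ι) (A : Matrix ι ι ℂ) (p : ι → ZMod 2),
    IsIndecomposable A ∧ IsUnit A.det ∧ IsContragredient H A p

end Class

end SuperLie

end

open SuperLie

universe u v

/-!
Every `t ∈ 𝔥ˣ` commutes with `x`, so on each generalized weight space of `𝔥ˣ` in `M` the operator
`x` is an odd map of square zero. Its homology, the corresponding generalized weight space of
`M_x`, has the same superdimension by rank-nullity. Hence `sch M_x`, pulled back along the
surjection `𝔥ˣ → 𝔥_x`, is the restriction of `sch M` to `𝔥ˣ`. This pull-back is injective on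
exponential sums, so restriction to `𝔥ˣ` factors uniquely through it, which gives `ds_x`. Since
the `x_β` lie in distinct root spaces, `𝔥ˣ` is where all the `β` vanish, and the substitutions do
not change values at such points.

That `[x, x] = 0` means that a nonzero sum `γ` of two of the roots, which is isotropic, has no
even root vector `y`. Otherwise, choose an even `z` of weight `-γ` with `(y, z) ≠ 0`. Then
`[y, z] ∈ 𝔥` is a nonzero multiple of the element dual to `γ`, on which `γ` vanishes, so the
commutator `ad [y, z]` of `ad y` and `ad z` commutes with both. It has trace zero on each of its
eigenspaces, hence no nonzero eigenvalue, and `[y, z]` is central. This is impossible: in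
`𝔤𝔩(m|n)` a nonzero scalar matrix is not a commutator of even elements, and an invertible Cartan
matrix forces trivial center in `𝔥`.
-/

namespace SuperLie

open Module SuperSpace LieSuperalgebra LieSupermodule

section Order

variable {α ι κ : Type*} [CompleteLattice α] [IsModularLattice α]

theorem iSup_inf_eq_of_iSupIndep {F : ι → α} {G : κ → α} (hG : iSupIndep G)
    (g : ι → κ) (hFG : ∀ i, F i ≤ G (g i)) (j : κ) :
    (⨆ i, F i) ⊓ G j = ⨆ (i) (_ : g i = j), F i := by
  have hj : ⨆ (i) (_ : g i = j), F i ≤ G j := iSup₂_le fun i hi => hi ▸ hFG i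
  have hne : ⨆ (i) (_ : g i ≠ j), F i ≤ ⨆ (k) (_ : k ≠ j), G k :=
    iSup₂_le fun i hi => (hFG i).trans (le_iSup₂_of_le (g i) hi le_rfl)
  rw [iSup_split F (g · = j), sup_inf_assoc_of_le _ hj,
    ((hG j).symm.mono_left hne).eq_bot, sup_bot_eq]

end Order

section Dimensions

variable {ι κ K N : Type*} [DivisionRing K] [AddCommGroup N] [Module K N] [FiniteDimensional K N]
  {G : ι → Submodule K N}

theorem finrank_biSup_of_iSupIndep (hG : iSupIndep G) (s : Finset ι) :
    finrank K ↥(⨆ i ∈ s, G i) = ∑ i ∈ s, finrank K (G i) := by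
  classical
  induction s using Finset.induction_on with
  | empty => simp
  | insert i s hi ih =>
    have hdisj : Disjoint (G i) (⨆ j ∈ s, G j) := hG.disjoint_biSup (y := (s : Set ι)) hi
    rw [Finset.iSup_insert, Finset.sum_insert hi, ← ih, ← Submodule.finrank_sup_add_finrank_inf_eq,
      hdisj.eq_bot, finrank_bot, add_zero]

theorem mapDomain_finrank_apply (hG : iSupIndep G) {d : ι →₀ ℤ}
    (hd : ∀ i, d i = finrank K (G i)) (g : ι → κ) (j : κ) :
    d.mapDomain g j = finrank K ↥(⨆ (i) (_ : g i = j), G i) := by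
  classical
  have hbot : ∀ i ∉ d.support, G i = ⊥ := fun i hi => by
    rwa [Finsupp.notMem_support_iff, hd, Nat.cast_eq_zero, Submodule.finrank_eq_zero] at hi
  have hsup : ⨆ (i) (_ : g i = j), G i = ⨆ i ∈ d.support.filter (g · = j), G i := by
    refine le_antisymm (iSup₂_le fun i hij => ?_)
      (biSup_mono fun i hi => (Finset.mem_filter.1 hi).2)
    by_cases hi : i ∈ d.support
    · exact le_iSup₂_of_le (f := fun i _ => G i) i (Finset.mem_filter.2 ⟨hi, hij⟩) le_rfl
    · rw [hbot i hi]
      exact bot_le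
  rw [hsup, finrank_biSup_of_iSupIndep hG, Nat.cast_sum, Finset.sum_filter, Finsupp.mapDomain,
    Finsupp.sum, Finsupp.finsetSum_apply]
  simp only [Finsupp.single_apply, hd]

end Dimensions

section WeightFamilies

variable {ι ι' K N N' : Type*} [Field K] [AddCommGroup N] [Module K N] [AddCommGroup N']
  [Module K N']

/-- The simultaneous generalized eigenspace of a family of operators. The system of eigenvalues
`χ` is an arbitrary function, so that no linearity of the family is needed. -/
def jointEigenspace (T : ι → End K N) (χ : ι → K) : Submodule K N :=
  ⨅ i, (T i).maxGenEigenspace (χ i)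

variable {T : ι → End K N} {T' : ι → End K N'} {P : Submodule K N}

theorem jointEigenspace_iSupIndep (hT : ∀ i j, Commute (T i) (T j)) :
    iSupIndep (jointEigenspace T) :=
  End.independent_iInf_maxGenEigenspace_of_forall_mapsTo T
    fun i j => End.mapsTo_maxGenEigenspace_of_comm (hT j i)

theorem jointEigenspace_inf_iSupIndep (hT : ∀ i j, Commute (T i) (T j)) (P : Submodule K N) :
    iSupIndep fun χ => jointEigenspace T χ ⊓ P :=
  (jointEigenspace_iSupIndep hT).mono fun _ => inf_le_left

theorem iSup_jointEigenspace_eq_top [IsAlgClosed K] [FiniteDimensional K N]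
    (hT : ∀ i j, Commute (T i) (T j)) : ⨆ χ, jointEigenspace T χ = ⊤ :=
  End.iSup_iInf_maxGenEigenspace_eq_top_of_iSup_maxGenEigenspace_eq_top_of_commute T
    (fun i j _ => hT i j) fun i => End.iSup_maxGenEigenspace_eq_top (T i)

theorem jointEigenspace_restrict (hP : ∀ i, ∀ v ∈ P, T i v ∈ P) (χ : ι → K) :
    jointEigenspace (fun i => (T i).restrict (hP i)) χ = (jointEigenspace T χ).comap P.subtype := by
  simp only [jointEigenspace, End.maxGenEigenspace, End.genEigenspace_restrict,
    Submodule.comap_iInf]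

theorem iSup_comap_jointEigenspace_eq_top [IsAlgClosed K] [FiniteDimensional K N]
    (hT : ∀ i j, Commute (T i) (T j)) (hP : ∀ i, ∀ v ∈ P, T i v ∈ P) :
    ⨆ χ, (jointEigenspace T χ).comap P.subtype = ⊤ := by
  simp only [← jointEigenspace_restrict hP]
  exact iSup_jointEigenspace_eq_top fun i j => LinearMap.restrict_commute (hT i j) (hP i) (hP j)

theorem iSup_jointEigenspace_inf [IsAlgClosed K] [FiniteDimensional K N]
    (hT : ∀ i j, Commute (T i) (T j)) (hP : ∀ i, ∀ v ∈ P, T i v ∈ P) :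
    ⨆ χ, jointEigenspace T χ ⊓ P = P := by
  simp only [inf_comm _ P, ← Submodule.map_comap_subtype, ← Submodule.map_iSup,
    iSup_comap_jointEigenspace_eq_top hT hP, Submodule.map_top, Submodule.range_subtype]

theorem jointEigenspace_le_comp (φ : ι' → ι) (χ : ι → K) :
    jointEigenspace T χ ≤ jointEigenspace (T ∘ φ) (χ ∘ φ) :=
  le_iInf fun i => iInf_le (fun i => (T i).maxGenEigenspace (χ i)) (φ i)

theorem jointEigenspace_comp_inf [IsAlgClosed K] [FiniteDimensional K N]
    (hT : ∀ i j, Commute (T i) (T j)) (hP : ∀ i, ∀ v ∈ P, T i v ∈ P) (φ : ι' → ι) (χ' : ι' → K) :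
    jointEigenspace (T ∘ φ) χ' ⊓ P =
      ⨆ (χ : ι → K) (_ : χ ∘ φ = χ'), jointEigenspace T χ ⊓ P := by
  rw [← iSup_inf_eq_of_iSupIndep (jointEigenspace_iSupIndep fun i j => hT (φ i) (φ j)) (· ∘ φ)
    (fun χ => inf_le_left.trans (jointEigenspace_le_comp φ χ)), iSup_jointEigenspace_inf hT hP,
    inf_comm]
  rfl

theorem map_jointEigenspace_le {f : N →ₗ[K] N'} (hf : ∀ i, f ∘ₗ T i = T' i ∘ₗ f) (χ : ι → K) :
    (jointEigenspace T χ).map f ≤ jointEigenspace T' χ := by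
  rintro _ ⟨v, hv, rfl⟩
  refine (Submodule.mem_iInf _).2 fun i => (End.mem_maxGenEigenspace _ _ _).2 ?_
  obtain ⟨k, hk⟩ := (End.mem_maxGenEigenspace _ _ _).1 ((Submodule.mem_iInf _).1 hv i)
  have hcomm : (T' i - χ i • 1) ∘ₗ f = f ∘ₗ (T i - χ i • 1) := by
    rw [LinearMap.sub_comp, ← hf, LinearMap.comp_sub]
    ext
    simp
  refine ⟨k, ?_⟩
  rw [← LinearMap.comp_apply, End.commute_pow_left_of_commute hcomm, LinearMap.comp_apply, hk,
    map_zero]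

theorem map_comap_jointEigenspace [IsAlgClosed K] [FiniteDimensional K N]
    (hT : ∀ i j, Commute (T i) (T j)) (hT' : ∀ i j, Commute (T' i) (T' j))
    (hP : ∀ i, ∀ v ∈ P, T i v ∈ P) (f : P →ₗ[K] N')
    (hf : ∀ i, f ∘ₗ (T i).restrict (hP i) = T' i ∘ₗ f) (χ : ι → K) :
    ((jointEigenspace T χ).comap P.subtype).map f = jointEigenspace T' χ ⊓ LinearMap.range f := by
  have h := iSup_inf_eq_of_iSupIndep (jointEigenspace_iSupIndep hT') id
    (fun χ => jointEigenspace_restrict hP χ ▸ map_jointEigenspace_le hf χ) χ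
  simpa only [id, iSup_iSup_eq_left, ← Submodule.map_iSup, iSup_comap_jointEigenspace_eq_top hT hP,
    Submodule.map_top, inf_comm] using h.symm

/-- The dimensions of the simultaneous generalized eigenspaces of a commuting family on a stable
subspace `P`, as a finitely supported function of the system of eigenvalues. -/
noncomputable def formalChar [FiniteDimensional K N] (hT : ∀ i j, Commute (T i) (T j))
    (P : Submodule K N) : (ι → K) →₀ ℤ :=
  Finsupp.ofSupportFinite (fun χ => finrank K ↥(jointEigenspace T χ ⊓ P)) <|
    (WellFoundedGT.finite_ne_bot_of_iSupIndep (jointEigenspace_inf_iSupIndep hT P)).subset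
      fun _ hχ hbot => hχ (Nat.cast_eq_zero.2 (Submodule.finrank_eq_zero.2 hbot))

theorem formalChar_apply [FiniteDimensional K N] (hT : ∀ i j, Commute (T i) (T j))
    (P : Submodule K N) (χ : ι → K) :
    formalChar hT P χ = finrank K ↥(jointEigenspace T χ ⊓ P) := rfl

theorem formalChar_eq_range_add_ker [IsAlgClosed K] [FiniteDimensional K N] [FiniteDimensional K N']
    (hT : ∀ i j, Commute (T i) (T j)) (hT' : ∀ i j, Commute (T' i) (T' j))
    (hP : ∀ i, ∀ v ∈ P, T i v ∈ P) (f : P →ₗ[K] N')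
    (hf : ∀ i, f ∘ₗ (T i).restrict (hP i) = T' i ∘ₗ f) :
    formalChar hT P =
      formalChar hT' (LinearMap.range f) + formalChar hT ((LinearMap.ker f).map P.subtype) := by
  ext χ
  have hrank :=
    (f.domRestrict ((jointEigenspace T χ).comap P.subtype)).finrank_range_add_finrank_ker
  have hker : ((jointEigenspace T χ).comap P.subtype ⊓ LinearMap.ker f).map P.subtype =
      jointEigenspace T χ ⊓ (LinearMap.ker f).map P.subtype := by
    rw [Submodule.map_inf _ P.injective_subtype, Submodule.map_comap_subtype, inf_comm P, inf_assoc,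
      inf_eq_right.2 (Submodule.map_subtype_le P _)]
  rw [LinearMap.range_domRestrict, map_comap_jointEigenspace hT hT' hP f hf,
    LinearMap.ker_domRestrict, ← Submodule.finrank_map_subtype_eq, Submodule.map_comap_subtype,
    ← Submodule.finrank_map_subtype_eq P, hker, ← Submodule.finrank_map_subtype_eq P,
    Submodule.map_comap_subtype, inf_comm P] at hrank
  simp only [Finsupp.add_apply, formalChar_apply, ← hrank, Nat.cast_add]

theorem formalChar_comp [IsAlgClosed K] [FiniteDimensional K N]
    (hT : ∀ i j, Commute (T i) (T j)) (hP : ∀ i, ∀ v ∈ P, T i v ∈ P) (φ : ι' → ι) :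
    formalChar (T := T ∘ φ) (fun i j => hT (φ i) (φ j)) P =
      (formalChar hT P).mapDomain (· ∘ φ) := by
  ext χ'
  rw [mapDomain_finrank_apply (jointEigenspace_inf_iSupIndep hT P) (formalChar_apply hT P),
    ← jointEigenspace_comp_inf hT hP, formalChar_apply]

theorem exists_dual_of_jointEigenspace_ne_bot {V : Type*} [AddCommGroup V] [Module K V]
    {T : V →ₗ[K] End K N} (hT : ∀ s t, Commute (T s) (T t)) {χ : V → K}
    (hχ : jointEigenspace T χ ≠ ⊥) : ∃ ν : Dual K V, ⇑ν = χ :=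
  ⟨{ toFun := χ
     map_add' := End.map_add_of_iInf_genEigenspace_ne_bot_of_commute T χ ⊤ hχ hT
     map_smul' := End.map_smul_of_iInf_genEigenspace_ne_bot T χ ⊤ hχ }, rfl⟩

end WeightFamilies

section Supercharacters

variable {L : Type*} [AddCommGroup L] [Module ℂ L] [LieSuperalgebra L] (H : EvenAbelian L)
  (M : Type*) [AddCommGroup M] [Module ℂ M] [SuperSpace M] [LieSupermodule L M]

/-- The operators by which a Cartan subalgebra acts on a module. -/
def cartanAct : H.carrier →ₗ[ℂ] End ℂ M := act ∘ₗ H.carrier.subtype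

theorem cartanAct_commute (s t : H.carrier) : Commute (cartanAct H M s) (cartanAct H M t) :=
  act_commute H M s t

variable {M} in
theorem cartanAct_mem_part (t : H.carrier) {i : ZMod 2} {m : M} (hm : m ∈ part (V := M) i) :
    cartanAct H M t m ∈ part (V := M) i :=
  zero_add i ▸ act_mem (H.le_even t.2) hm

variable {M} in
/-- The character of a stable subspace `P` of a module, with respect to the weights pulled back
along a map `φ` to the Cartan subalgebra. -/
noncomputable def pullbackChar [FiniteDimensional ℂ M] {S : Type*} (φ : S → H.carrier)
    (P : Submodule ℂ M) : (S → ℂ) →₀ ℤ :=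
  formalChar (T := cartanAct H M ∘ φ) (fun _ _ => cartanAct_commute H M _ _) P

theorem mapDomain_coeff_sch [FiniteDimensional ℂ M] :
    (sch H M).coeff.mapDomain (⇑) =
      pullbackChar H id (part (V := M) 0) - pullbackChar H id (part (V := M) 1) := by
  ext χ
  by_cases hχ : ∃ μ : H.Weight, ⇑μ = χ
  · obtain ⟨μ, rfl⟩ := hχ
    rw [Finsupp.mapDomain_apply DFunLike.coe_injective]
    rfl
  · have hbot : jointEigenspace (cartanAct H M) χ = ⊥ :=
      of_not_not (mt (exists_dual_of_jointEigenspace_ne_bot (cartanAct_commute H M)) hχ)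
    rw [Finsupp.mapDomain_of_notMem_range _ _ hχ, Finsupp.sub_apply, pullbackChar, pullbackChar,
      formalChar_apply, formalChar_apply, Function.comp_id, hbot, bot_inf_eq, bot_inf_eq, sub_self]

theorem mapDomain_coeff_pullbackExp_sch [FiniteDimensional ℂ M] {V : Type*} [AddCommGroup V]
    [Module ℂ V] (φ : V →ₗ[ℂ] H.carrier) :
    (pullbackExp φ (sch H M)).coeff.mapDomain (⇑) =
      pullbackChar H φ (part (V := M) 0) - pullbackChar H φ (part (V := M) 1) := by
  have hchar (i : ZMod 2) : pullbackChar H φ (part (V := M) i) =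
      (pullbackChar H id (part (V := M) i)).mapDomain (· ∘ φ) :=
    formalChar_comp (cartanAct_commute H M) (fun t _ => cartanAct_mem_part H t) φ
  rw [hchar, hchar, ← Finsupp.mapDomain_sub, ← mapDomain_coeff_sch, ← Finsupp.mapDomain_comp]
  exact (Finsupp.mapDomain_comp ..).symm

variable {H M} {x : OddPart L}

theorem imx_le_kerx (hxx : bracket (x : L) (x : L) = 0) : imx x M ≤ kerx x M := by
  rintro _ ⟨w, rfl⟩
  have h := act_bracket (L := L) w x.2 x.2
  rw [hxx, map_zero, LinearMap.zero_apply, superSign, if_pos ⟨rfl, rfl⟩, neg_one_smul,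
    sub_neg_eq_add, ← two_smul ℂ, eq_comm, smul_eq_zero, or_iff_right two_ne_zero] at h
  exact mem_kerx.2 h

theorem isCompl_part_one_add (M : Type*) [AddCommGroup M] [Module ℂ M] [SuperSpace M]
    (i : ZMod 2) : IsCompl (part (V := M) i) (part (V := M) (1 + i)) := by
  fin_cases i
  exacts [isCompl_part, isCompl_part.symm]

theorem map_act_part (x : OddPart L) (i : ZMod 2) :
    (part (V := M) i).map (act (x : L)) = part (V := M) (1 + i) ⊓ imx x M := by
  have hodd (j : ZMod 2) : (part (V := M) j).map (act (x : L)) ≤ part (V := M) (1 + j) :=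
    Submodule.map_le_iff_le_comap.2 fun m hm => act_mem x.2 hm
  have himx : imx x M =
      (part (V := M) i).map (act (x : L)) ⊔ (part (V := M) (1 + i)).map (act (x : L)) := by
    rw [← Submodule.map_sup, (isCompl_part_one_add M i).sup_eq_top, Submodule.map_top]
    rfl
  have hdisj : Disjoint ((part (V := M) (1 + i)).map (act (x : L))) (part (V := M) (1 + i)) :=
    (isCompl_part_one_add M (1 + i)).disjoint.symm.mono_left (hodd (1 + i))
  rw [himx, inf_comm, sup_inf_assoc_of_le _ (hodd i), hdisj.eq_bot, sup_bot_eq]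

theorem act_comp_cartanAct (t : hCent H x) :
    act (x : L) ∘ₗ cartanAct H M t = cartanAct H M t ∘ₗ act (x : L) := by
  ext m
  have ht : bracket (x : L) (t : H.carrier) = 0 := mem_kerx.1 t.2
  simpa [cartanAct, ht, superSign] using act_x_act (x := x) (H.le_even t.1.2) m

theorem cartanAct_mem_kerx (t : hCent H x) {m : M} (hm : m ∈ kerx x M) :
    cartanAct H M t m ∈ kerx x M :=
  act_mem_kerx t.2 hm

theorem pullbackChar_part [FiniteDimensional ℂ M] (i : ZMod 2) :
    pullbackChar H (hCent H x).subtype (part (V := M) i) =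
      pullbackChar H (hCent H x).subtype (part (V := M) (1 + i) ⊓ imx x M) +
        pullbackChar H (hCent H x).subtype (part (V := M) i ⊓ kerx x M) := by
  have h := formalChar_eq_range_add_ker (T := cartanAct H M ∘ (hCent H x).subtype)
    (T' := cartanAct H M ∘ (hCent H x).subtype) (fun _ _ => cartanAct_commute H M _ _)
    (fun _ _ => cartanAct_commute H M _ _) (P := part i) (fun t _ => cartanAct_mem_part H t)
    ((act (x : L)).domRestrict (part i))
    fun t => LinearMap.ext fun m => LinearMap.congr_fun (act_comp_cartanAct t) (m : M)
  rwa [LinearMap.range_domRestrict, map_act_part, LinearMap.ker_domRestrict,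
    Submodule.map_comap_subtype] at h

theorem pullbackChar_part_inf_kerx [FiniteDimensional ℂ M] (hxx : bracket (x : L) (x : L) = 0)
    (i : ZMod 2) :
    pullbackChar H (hCent H x).subtype (part (V := M) i ⊓ kerx x M) =
      pullbackChar (H.ds x) (toHx H x) (part (V := DSMod x M) i) +
        pullbackChar H (hCent H x).subtype (part (V := M) i ⊓ imx x M) := by
  let f : ↥(part (V := M) i ⊓ kerx x M) →ₗ[ℂ] DSMod x M :=
    DSMod.mk x M ∘ₗ Submodule.inclusion inf_le_right
  have hrange : LinearMap.range f = part (V := DSMod x M) i := by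
    rw [LinearMap.range_comp, Submodule.range_inclusion, Submodule.comap_inf,
      Submodule.comap_subtype_self, inf_top_eq]
    rfl
  have hker : (LinearMap.ker f).map (part (V := M) i ⊓ kerx x M).subtype = part i ⊓ imx x M := by
    ext m
    constructor
    · rintro ⟨m, hm, rfl⟩
      exact ⟨m.2.1, DSMod.mk_eq_zero.1 hm⟩
    · rintro ⟨hmi, hmx⟩
      exact ⟨⟨m, hmi, imx_le_kerx hxx hmx⟩, DSMod.mk_eq_zero.2 hmx, rfl⟩
  rw [← hrange, ← hker]
  exact formalChar_eq_range_add_ker (T := cartanAct H M ∘ (hCent H x).subtype)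
    (T' := cartanAct (H.ds x) (DSMod x M) ∘ toHx H x) (fun _ _ => cartanAct_commute H M _ _)
    (fun _ _ => cartanAct_commute (H.ds x) (DSMod x M) _ _)
    (fun t _ hm => Submodule.mem_inf.2
      ⟨cartanAct_mem_part H t.1 hm.1, cartanAct_mem_kerx t hm.2⟩) f fun _ => rfl

theorem pullbackExp_sch_DSMod [FiniteDimensional ℂ M] (hxx : bracket (x : L) (x : L) = 0) :
    pullbackExp (toHx H x) (sch (H.ds x) (DSMod x M)) =
      pullbackExp (hCent H x).subtype (sch H M) := by
  apply AddMonoidAlgebra.coeff_injective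
  apply Finsupp.mapDomain_injective (f := fun μ : Dual ℂ (hCent H x) => ⇑μ) DFunLike.coe_injective
  have h0 := pullbackChar_part (H := H) (x := x) (M := M) 0
  have h1 := pullbackChar_part (H := H) (x := x) (M := M) 1
  rw [add_zero] at h0
  rw [CharTwo.add_self_eq_zero] at h1
  rw [mapDomain_coeff_pullbackExp_sch, mapDomain_coeff_pullbackExp_sch, h0, h1,
    pullbackChar_part_inf_kerx hxx, pullbackChar_part_inf_kerx hxx]
  abel

end Supercharacters

section ExponentialSums

variable {V W U : Type*} [AddCommGroup V] [Module ℂ V] [AddCommGroup W] [Module ℂ W]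
  [AddCommGroup U] [Module ℂ U]

theorem pullbackExp_comp (φ : V →ₗ[ℂ] W) (ψ : W →ₗ[ℂ] U) (f : AddMonoidAlgebra ℤ (Dual ℂ U)) :
    pullbackExp (ψ ∘ₗ φ) f = pullbackExp φ (pullbackExp ψ f) :=
  AddMonoidAlgebra.coeff_injective (Finsupp.mapDomain_comp (f := ψ.dualMap) (g := φ.dualMap))

theorem pullbackExp_injective {φ : V →ₗ[ℂ] W} (hφ : Function.Surjective φ) :
    Function.Injective (pullbackExp φ) :=
  AddMonoidAlgebra.mapDomain_injective (LinearMap.dualMap_injective_of_surjective hφ)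

theorem evalAt_pullbackExp (φ : V →ₗ[ℂ] W) (f : AddMonoidAlgebra ℤ (Dual ℂ W)) (t : V) :
    evalAt (pullbackExp φ f) t = evalAt f (φ t) :=
  Finsupp.sum_mapDomain_index (by simp) (by simp [add_mul])

end ExponentialSums

theorem existsUnique_comp_eq {R S T : Type*} [Ring R] [Ring S] [Ring T] {i : R →+* T}
    {j : S →+* T} (hj : Function.Injective j) (hij : i.range ≤ j.range) :
    ∃! g : R →+* S, j.comp g = i := by
  let e : S ≃+* j.range := RingEquiv.ofBijective j.rangeRestrict
    ⟨fun a b h => hj (congrArg Subtype.val h), j.rangeRestrict_surjective⟩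
  let g : R →+* S := (e.symm : j.range →+* S).comp (i.codRestrict j.range fun a => hij ⟨a, rfl⟩)
  have hg : j.comp g = i := RingHom.ext fun a => congrArg Subtype.val (e.apply_symm_apply _)
  exact ⟨g, hg, fun g' hg' => RingHom.ext fun a => hj (RingHom.congr_fun (hg'.trans hg.symm) a)⟩

theorem ringHom_closure_ext {R S : Type*} [Ring R] [Ring S] {s : Set R}
    {φ ψ : Subring.closure s →+* S}
    (h : ∀ a (ha : a ∈ s), φ ⟨a, Subring.subset_closure ha⟩ = ψ ⟨a, Subring.subset_closure ha⟩) :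
    φ = ψ := by
  have hle : Subring.closure s ≤ (φ.eqLocus ψ).map (Subring.closure s).subtype :=
    Subring.closure_le.2 fun a ha => ⟨⟨a, Subring.subset_closure ha⟩, h a ha, rfl⟩
  ext a
  obtain ⟨b, hb, hba⟩ := hle a.2
  exact Subtype.ext hba ▸ hb

section DS

variable {L : Type u} [AddCommGroup L] [Module ℂ L] [LieSuperalgebra L] {H : EvenAbelian L}
  {x : OddPart L}

theorem toHx_surjective : Function.Surjective (toHx H x) := LinearMap.surjective_rangeRestrict _

theorem isDS_iff_comp_eq (hxx : bracket (x : L) (x : L) = 0)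
    {ds : superCharRing.{u, v} H →+* superCharRing.{u, v} (H.ds x)} :
    IsDS H x ds ↔ ((pullbackExp (toHx H x)).comp (superCharRing (H.ds x)).subtype).comp ds =
      (pullbackExp (hCent H x).subtype).comp (superCharRing H).subtype := by
  constructor
  · intro hds
    refine ringHom_closure_ext ?_
    rintro _ ⟨M, _, _, _, _, _, rfl⟩
    exact (congrArg (fun g => pullbackExp (toHx H x) g.1) (hds M)).trans (pullbackExp_sch_DSMod hxx)
  · intro h M _ _ _ _ _
    exact Subtype.ext <| pullbackExp_injective toHx_surjective <|
      (RingHom.congr_fun h (schClass H M)).trans (pullbackExp_sch_DSMod hxx).symm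

theorem existsUnique_isDS (hxx : bracket (x : L) (x : L) = 0) :
    ∃! ds : superCharRing.{u, v} H →+* superCharRing.{u, v} (H.ds x), IsDS H x ds := by
  simp only [isDS_iff_comp_eq hxx]
  refine existsUnique_comp_eq
    ((pullbackExp_injective toHx_surjective).comp Subtype.val_injective) ?_
  rw [← RingHom.map_range, Subring.range_subtype, Subring.map_le_iff_le_comap, superCharRing,
    Subring.closure_le]
  rintro _ ⟨M, _, _, _, _, _, rfl⟩
  exact ⟨schClass (H.ds x) (DSMod x M), pullbackExp_sch_DSMod hxx⟩

variable {ds : superCharRing.{u, v} H →+* superCharRing.{u, v} (H.ds x)}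

theorem IsDS.pullbackExp_toHx (hds : IsDS H x ds) (hxx : bracket (x : L) (x : L) = 0)
    (f : superCharRing.{u, v} H) :
    pullbackExp (toHx H x) (ds f).1 = pullbackExp (hCent H x).subtype f.1 :=
  RingHom.congr_fun ((isDS_iff_comp_eq hxx).1 hds) f

theorem IsDS.evalAt_toHx (hds : IsDS H x ds) (hxx : bracket (x : L) (x : L) = 0)
    (f : superCharRing.{u, v} H) (t : hCent H x) :
    evalAt (ds f).1 (toHx H x t) = evalAt f.1 (t : H.carrier) := by
  rw [← evalAt_pullbackExp, hds.pullbackExp_toHx hxx, evalAt_pullbackExp, Submodule.subtype_apply]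

theorem IsDS.pullbackExp_embeddedToHx (hds : IsDS H x ds) (hxx : bracket (x : L) (x : L) = 0)
    {k : Submodule ℂ L} (hk : IsEmbeddedDS x k) (f : superCharRing.{u, v} H) :
    pullbackExp (embeddedToHx H hk) (ds f).1 =
      pullbackExp (k.comap H.carrier.subtype).subtype f.1 := by
  rw [embeddedToHx, pullbackExp_comp, hds.pullbackExp_toHx hxx, ← pullbackExp_comp,
    Submodule.subtype_comp_inclusion]

end DS

section IsotropicRoots

theorem eigenspace_commutator_eq_bot {K N : Type*} [Field K] [CharZero K] [AddCommGroup N]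
    [Module K N] [FiniteDimensional K N] {S T : End K N} (hS : Commute (S * T - T * S) S)
    (hT : Commute (S * T - T * S) T) {c : K} (hc : c ≠ 0) :
    (S * T - T * S).eigenspace c = ⊥ := by
  set E := (S * T - T * S).eigenspace c
  have hSE : ∀ w ∈ E, S w ∈ E := fun w hw => End.mapsTo_genEigenspace_of_comm hS c 1 hw
  have hTE : ∀ w ∈ E, T w ∈ E := fun w hw => End.mapsTo_genEigenspace_of_comm hT c 1 hw
  have hcomm : S.restrict hSE * T.restrict hTE - T.restrict hTE * S.restrict hSE =
      c • LinearMap.id :=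
    LinearMap.ext fun w => Subtype.ext (End.mem_eigenspace_iff.1 w.2)
  have htrace := congrArg (LinearMap.trace K E) hcomm
  rwa [map_sub, LinearMap.trace_mul_comm, sub_self, map_smul, LinearMap.trace_id, smul_eq_mul,
    eq_comm, mul_eq_zero, or_iff_right hc, Nat.cast_eq_zero, Submodule.finrank_eq_zero] at htrace

theorem superSign_zero_left (j : ZMod 2) : superSign 0 j = 1 := by
  simp [superSign]

theorem superSign_zero_right (i : ZMod 2) : superSign i 0 = 1 := by
  simp [superSign]

variable {L : Type*} [AddCommGroup L] [Module ℂ L] [LieSuperalgebra L] {H : EvenAbelian L}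
  {Φ : InvariantForm L} {α β γ δ : H.Weight} {t : H.carrier}

theorem bracket_leibniz_of_even {a : L} (ha : a ∈ part (V := L) 0) (b c : L) :
    bracket a (bracket b c) = bracket (bracket a b) c + bracket b (bracket a c) := by
  obtain ⟨b₀, hb₀, b₁, hb₁, rfl⟩ := exists_decomp b
  simp only [map_add, LinearMap.add_apply, bracket_jacobi c ha hb₀, bracket_jacobi c ha hb₁,
    superSign_zero_left, one_smul]
  abel

theorem bracket_skew_of_even {a : L} (ha : a ∈ part (V := L) 0) (b : L) :
    bracket b a = -bracket a b := by
  obtain ⟨b₀, hb₀, b₁, hb₁, rfl⟩ := exists_decomp b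
  simp only [map_add, LinearMap.add_apply, bracket_skew hb₀ ha, bracket_skew hb₁ ha,
    superSign_zero_right, one_smul, neg_add]

theorem bracket_mem_rootSpace {a b : L} (ha : a ∈ rootSpace H α) (hb : b ∈ rootSpace H β) :
    bracket a b ∈ rootSpace H (α + β) := fun t => by
  rw [bracket_leibniz_of_even (H.le_even t.2), ha t, hb t, LinearMap.add_apply, add_smul, map_smul,
    map_smul, LinearMap.smul_apply]

theorem mem_rootSpace_of_add_mem {a b : L} (ha : a ∈ part (V := L) 0) (hb : b ∈ part (V := L) 1)
    (hab : a + b ∈ rootSpace H α) : a ∈ rootSpace H α := fun t => by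
  have hpart (i : ZMod 2) {c : L} (hc : c ∈ part (V := L) i) :
      bracket (t : L) c - α t • c ∈ part (V := L) i :=
    sub_mem (zero_add i ▸ bracket_mem (H.le_even t.2) hc) (Submodule.smul_mem _ _ hc)
  refine sub_eq_zero.1 (eq_zero_of_add_eq_zero (hpart 0 ha) (hpart 1 hb) ?_).1
  rw [sub_add_sub_comm, ← map_add, hab t, smul_add, sub_self]

theorem rootSpace_iSupIndep (H : EvenAbelian L) : iSupIndep (rootSpace H) :=
  ((jointEigenspace_iSupIndep (cartanAct_commute H L)).comp
    (f := fun μ : H.Weight => ⇑μ) DFunLike.coe_injective).mono fun μ a ha =>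
    (Submodule.mem_iInf _).2 fun t => (End.mem_maxGenEigenspace _ _ _).2
      ⟨1, by rw [pow_one, LinearMap.sub_apply]; exact sub_eq_zero.2 (ha t)⟩

theorem mem_hCent_iff {ι : Type*} [Fintype ι] {β : ι → H.Weight} (hβ : Function.Injective β)
    {xβ : ι → L} (hxβ : ∀ i, xβ i ∈ rootSpace H (β i)) (hxβ0 : ∀ i, xβ i ≠ 0) {x : OddPart L}
    (hx : (x : L) = ∑ i, xβ i) : t ∈ hCent H x ↔ ∀ i, β i t = 0 := by
  have hli : LinearIndependent ℂ xβ :=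
    ((rootSpace_iSupIndep H).comp hβ).linearIndependent _ hxβ hxβ0
  have hbracket : bracket (x : L) (t : L) = -∑ i, β i t • xβ i := by
    rw [bracket_skew_of_even (H.le_even t.2), hx, map_sum]
    simp only [hxβ _ t]
  have hmem : t ∈ hCent H x ↔ bracket (x : L) (t : L) = 0 := mem_kerx
  rw [hmem, hbracket, neg_eq_zero]
  exact ⟨Fintype.linearIndependent_iff.1 hli _, fun h => Finset.sum_eq_zero fun i _ => by
    rw [h i, zero_smul]⟩

theorem exists_even_mem_rootSpace_neg_form_ne_zero (hH : ⨆ α, rootSpace H α = ⊤)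
    (Φ : InvariantForm L) {y : L} (hy : y ∈ rootSpace H γ) (hy₀ : y ∈ part (V := L) 0)
    (hne : y ≠ 0) : ∃ z ∈ rootSpace H (-γ), z ∈ part (V := L) 0 ∧ Φ.form y z ≠ 0 := by
  obtain ⟨α, z, hz, hyz⟩ : ∃ α : H.Weight, ∃ z ∈ rootSpace H α, Φ.form y z ≠ 0 := by
    by_contra! hzero
    have hle : ⨆ α, rootSpace H α ≤ LinearMap.ker (Φ.form y) := iSup_le hzero
    rw [hH, top_le_iff, LinearMap.ker_eq_top] at hle
    exact hne (Φ.nondegenerate.1 y (LinearMap.congr_fun hle))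
  obtain rfl : α = -γ := by
    ext t
    have hinv := Φ.invariant y (t : L) z
    rw [bracket_skew_of_even (H.le_even t.2), hy t, hz t, map_neg, LinearMap.neg_apply, map_smul,
      LinearMap.smul_apply, map_smul, ← neg_smul] at hinv
    exact (smul_left_injective ℂ hyz hinv).symm
  obtain ⟨z₀, hz₀, z₁, hz₁, rfl⟩ := exists_decomp z
  rw [map_add, Φ.even hy₀ hz₁ zero_ne_one, add_zero] at hyz
  exact ⟨z₀, mem_rootSpace_of_add_mem hz₀ hz₁ hz, hz₀, hyz⟩

theorem InvariantForm.form_comm (s t : H.carrier) :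
    Φ.form (s : L) (t : L) = Φ.form (t : L) (s : L) := by
  rw [Φ.supersymm (H.le_even s.2) (H.le_even t.2), superSign_zero_left, one_mul]

theorem InvariantForm.Orthogonal.symm (h : Φ.Orthogonal H α β) : Φ.Orthogonal H β α := by
  obtain ⟨s, t, hs, ht, hst⟩ := h
  exact ⟨t, s, ht, hs, InvariantForm.form_comm t s ▸ hst⟩

theorem InvariantForm.Orthogonal.apply_eq_zero (h : Φ.Orthogonal H α β) {s : H.carrier}
    (hs : Φ.Represents H s α) : β s = 0 := by
  obtain ⟨s', t, hs', ht, hst⟩ := h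
  rw [← ht s, InvariantForm.form_comm, hs t, ← hs' t, hst]

theorem InvariantForm.Orthogonal.add_self (hα : Φ.Orthogonal H α α) (hβ : Φ.Orthogonal H β β)
    (hαβ : Φ.Orthogonal H α β) : Φ.Orthogonal H (α + β) (α + β) := by
  obtain ⟨s, t, hs, ht, -⟩ := id hαβ
  have hst : Φ.Represents H (s + t) (α + β) := fun u => by
    rw [Submodule.coe_add, map_add, LinearMap.add_apply, hs u, ht u, LinearMap.add_apply]
  refine ⟨s + t, s + t, hst, hst, ?_⟩
  rw [hst, LinearMap.add_apply, map_add, map_add, hα.apply_eq_zero hs, hαβ.apply_eq_zero hs,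
    hβ.apply_eq_zero ht, hαβ.symm.apply_eq_zero ht, add_zero, add_zero]

theorem commute_bracket_of_root_apply_eq_zero {z : L} (hz : z ∈ rootSpace H δ) (hδt : δ t = 0) :
    Commute (bracket (t : L) : End ℂ L) (bracket z) := by
  ext a
  rw [End.mul_apply, End.mul_apply, bracket_leibniz_of_even (H.le_even t.2), hz t, hδt, zero_smul,
    map_zero, LinearMap.zero_apply, zero_add]

theorem bracket_eq_zero_of_root_apply_eq_zero [FiniteDimensional ℂ L]
    (hH : ⨆ α, rootSpace H α = ⊤) {y z : L} (hy : y ∈ rootSpace H γ) (hy₀ : y ∈ part (V := L) 0)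
    (hz : z ∈ rootSpace H (-γ)) (ht : (t : L) = bracket y z) (hγt : γ t = 0) :
    bracket (t : L) = 0 := by
  have had : bracket (t : L) = (bracket y * bracket z - bracket z * bracket y : End ℂ L) := by
    ext a
    rw [ht, LinearMap.sub_apply, End.mul_apply, End.mul_apply, bracket_leibniz_of_even hy₀,
      add_sub_cancel_right]
  have hty := commute_bracket_of_root_apply_eq_zero hy hγt
  have htz := commute_bracket_of_root_apply_eq_zero hz (by rw [LinearMap.neg_apply, hγt, neg_zero])
  rw [← LinearMap.ker_eq_top, ← top_le_iff, ← hH]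
  refine iSup_le fun α a ha => LinearMap.mem_ker.2 ?_
  by_cases hαt : α t = 0
  · rw [ha t, hαt, zero_smul]
  · have hmem : a ∈ End.eigenspace (bracket (t : L)) (α t) := End.mem_eigenspace_iff.2 (ha t)
    rw [had] at hty htz hmem
    rw [eigenspace_commutator_eq_bot hty htz hαt, Submodule.mem_bot] at hmem
    rw [hmem, map_zero]

theorem IsContragredient.eq_zero_of_bracket_eq_zero [FiniteDimensional ℂ H.carrier] {ι : Type}
    [Fintype ι] [DecidableEq ι] {A : Matrix ι ι ℂ} {p : ι → ZMod 2} (hA : IsUnit A.det)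
    (hL : IsContragredient H A p) (ht : bracket (t : L) = 0) : t = 0 := by
  obtain ⟨h, α, e, f, hh, hα, hdim, -, -, hef, hbracket, -, -⟩ := hL
  have hαt (i : ι) : α i t = 0 := by
    have he : e i ≠ 0 := fun he => hh.ne_zero i <| Subtype.ext <| by
      simpa [he] using (hbracket i i).symm
    simpa [ht, he] using ((hef i).1 t).symm
  have hspan : Submodule.span ℂ (Set.range α) = ⊤ := by
    refine hα.span_eq_top_of_card_eq_finrank' ?_
    rw [Matrix.rank_of_isUnit A ((Matrix.isUnit_iff_isUnit_det A).2 hA)] at hdim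
    rw [Subspace.dual_finrank_eq]
    omega
  have hle : Submodule.span ℂ (Set.range α) ≤ LinearMap.ker (Dual.eval ℂ H.carrier t) :=
    Submodule.span_le.2 (Set.range_subset_iff.2 hαt)
  rw [hspan, top_le_iff, LinearMap.ker_eq_top] at hle
  exact (forall_dual_apply_eq_zero_iff ℂ t).1 (LinearMap.congr_fun hle)

theorem IsGL.eq_zero_of_bracket_eq_zero {m n : ℕ} (hL : IsGL H m n) (ht : bracket (t : L) = 0)
    {y z : L} (hy : y ∈ part (V := L) 0) (hz : z ∈ part (V := L) 0)
    (hyz : (t : L) = bracket y z) : t = 0 := by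
  obtain ⟨φ, hpart, hbracket, -⟩ := hL
  have htrace : (φ t).trace = 0 := by
    rw [hyz, hbracket 0 0 y z hy hz, superSign_zero_left, one_smul, Matrix.trace_sub,
      Matrix.trace_mul_comm, sub_self]
  have hsingle (r s : Fin m ⊕ Fin n) : Commute (Matrix.single r s 1) (φ t) := by
    have hmem : φ.symm (Matrix.single r s 1) ∈ part (V := L) (idxParity r + idxParity s) :=
      (hpart _ _).2 fun r' s' hne => by
        rw [LinearEquiv.apply_symm_apply, Matrix.single_apply, if_neg]
        rintro ⟨rfl, rfl⟩
        exact hne rfl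
    have h := hbracket _ _ _ _ (H.le_even t.2) hmem
    rw [ht, LinearMap.zero_apply, map_zero, superSign_zero_left, one_smul,
      LinearEquiv.apply_symm_apply, eq_comm, sub_eq_zero] at h
    exact h.symm
  obtain ⟨c, hc⟩ := Matrix.mem_range_scalar_of_commute_single fun r s _ => hsingle r s
  have hφt : φ t = 0 := by
    rw [← hc] at htrace ⊢
    rcases isEmpty_or_nonempty (Fin m ⊕ Fin n) with _ | _
    · exact Subsingleton.elim _ _
    · rw [Matrix.scalar_apply, Matrix.trace_diagonal, Finset.sum_const, smul_eq_zero,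
        or_iff_right (Finset.card_pos.2 Finset.univ_nonempty).ne'] at htrace
      rw [htrace, map_zero]
  exact Subtype.ext (φ.map_eq_zero_iff.1 hφt)

theorem IsContragredientOrGL.eq_zero_of_bracket_eq_zero [FiniteDimensional ℂ H.carrier]
    (hL : IsContragredientOrGL H) (ht : bracket (t : L) = 0) {y z : L} (hy : y ∈ part (V := L) 0)
    (hz : z ∈ part (V := L) 0) (hyz : (t : L) = bracket y z) : t = 0 := by
  obtain ⟨m, n, hGL⟩ | ⟨ι, _, _, A, p, -, hA, hA'⟩ := hL
  exacts [hGL.eq_zero_of_bracket_eq_zero ht hy hz hyz, hA'.eq_zero_of_bracket_eq_zero hA ht]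

theorem rootSpace_inf_part_zero_eq_bot [FiniteDimensional ℂ L] (hH : H.IsCartan)
    (hL : IsContragredientOrGL H) (hγ : Φ.Orthogonal H γ γ) (hγ0 : γ ≠ 0) :
    rootSpace H γ ⊓ part 0 = ⊥ := by
  refine (Submodule.eq_bot_iff _).2 fun y ⟨hy, hy₀⟩ => ?_
  by_contra hne
  obtain ⟨z, hz, hz₀, hyz⟩ :=
    exists_even_mem_rootSpace_neg_form_ne_zero hH.iSup_rootSpace Φ hy hy₀ hne
  have hmem : bracket y z ∈ H.carrier := by
    rw [← hH.rootSpace_zero, ← add_neg_cancel γ]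
    exact bracket_mem_rootSpace hy hz
  obtain ⟨t, ht⟩ : ∃ t : H.carrier, (t : L) = bracket y z := ⟨⟨_, hmem⟩, rfl⟩
  have hform (s : H.carrier) : Φ.form (t : L) (s : L) = γ s * Φ.form y z := by
    rw [ht, Φ.invariant, bracket_skew_of_even (H.le_even s.2), hz s, LinearMap.neg_apply, neg_smul,
      neg_neg, map_smul, smul_eq_mul]
  obtain ⟨s, -, hs, -⟩ := id hγ
  have hγt : γ t = 0 := by
    rw [← hs t, InvariantForm.form_comm, hform, hγ.apply_eq_zero hs, zero_mul]
  have ht0 : t = 0 := hL.eq_zero_of_bracket_eq_zero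
    (bracket_eq_zero_of_root_apply_eq_zero hH.iSup_rootSpace hy hy₀ hz ht hγt) hy₀ hz₀ ht
  refine hγ0 (LinearMap.ext fun s => ?_)
  simpa [ht0, hyz] using (hform s).symm

theorem IsIsotropicSet.add_ne_zero {k : ℕ} {β : Fin k → H.Weight} (hβ : IsIsotropicSet Φ H β)
    (i j : Fin k) : β i + β j ≠ 0 := fun h => by
  rcases eq_or_ne i j with rfl | hij
  · rw [← two_smul ℂ, smul_eq_zero, or_iff_right two_ne_zero] at h
    exact (hβ.odd_root i).1 h
  · exact (hβ.ne i j hij).2 (eq_neg_of_add_eq_zero_left h)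

theorem IsIsotropicSet.bracket_sum_self_eq_zero [FiniteDimensional ℂ L] (hH : H.IsCartan)
    (hL : IsContragredientOrGL H) {k : ℕ} {β : Fin k → H.Weight} (hβ : IsIsotropicSet Φ H β)
    {xβ : Fin k → L} (hxβ : ∀ i, xβ i ∈ rootSpace H (β i)) :
    bracket (∑ i, xβ i) (∑ i, xβ i) = 0 := by
  have hij (i j : Fin k) : bracket (xβ i) (xβ j) = 0 := by
    have horth := (hβ.orthogonal i i).add_self (hβ.orthogonal j j) (hβ.orthogonal i j)
    rw [← Submodule.mem_bot ℂ, ← rootSpace_inf_part_zero_eq_bot hH hL horth (hβ.add_ne_zero i j)]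
    exact ⟨bracket_mem_rootSpace (hxβ i) (hxβ j),
      bracket_mem ((hβ.odd_root i).2.2 (hxβ i)) ((hβ.odd_root j).2.2 (hxβ j))⟩
  simp only [map_sum, LinearMap.sum_apply, hij, Finset.sum_const_zero]

end IsotropicRoots

section Substitutions

variable {ν ν' κ V W : Type*} [Fintype ν] [Fintype ν'] [AddCommGroup V] [Module ℂ V]
  [AddCommGroup W] [Module ℂ W]

theorem substMonomials_substMonomials (w : ν → W) (w' : ν' → ν → ℂ)
    (F : AddMonoidAlgebra ℤ (ν' → ℂ)) :
    substMonomials w (substMonomials w' F) =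
      substMonomials (fun i => Fintype.linearCombination ℂ w (w' i)) F := by
  have hcomp : Fintype.linearCombination ℂ w ∘ Fintype.linearCombination ℂ w' =
      Fintype.linearCombination ℂ fun i => Fintype.linearCombination ℂ w (w' i) := by
    ext c
    simp only [Function.comp_apply, Fintype.linearCombination_apply ℂ _ c, map_sum, map_smul]
  apply AddMonoidAlgebra.coeff_injective
  change (F.coeff.mapDomain _).mapDomain _ = F.coeff.mapDomain _
  rw [← Finsupp.mapDomain_comp]
  exact congrArg (F.coeff.mapDomain ·) hcomp

theorem linearCombination_varExp [DecidableEq ν] (w : ν → W) (i : ν) :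
    Fintype.linearCombination ℂ w (varExp i) = w i := by
  rw [varExp, Fintype.linearCombination_apply_single, one_smul]

theorem evalAt_substMonomials (w : ν → Dual ℂ V) (F : AddMonoidAlgebra ℤ (ν → ℂ)) (t : V) :
    evalAt (substMonomials w F) t =
      F.coeff.sum fun c n => (n : ℂ) * Complex.exp (∑ i, c i * w i t) := by
  refine (Finsupp.sum_mapDomain_index (by simp) (by simp [add_mul])).trans ?_
  simp [Fintype.linearCombination_apply, LinearMap.sum_apply]

theorem evalAt_substMonomials_substMonomials {w : ν → Dual ℂ V} {w' : ν → ν → ℂ} {t : V}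
    (h : ∀ i, Fintype.linearCombination ℂ w (w' i) t = w i t) (F : AddMonoidAlgebra ℤ (ν → ℂ)) :
    evalAt (substMonomials w (substMonomials w' F)) t = evalAt (substMonomials w F) t := by
  simp only [substMonomials_substMonomials, evalAt_substMonomials, h]

theorem evalAt_substMonomials_update [DecidableEq ν] {w : ν → Dual ℂ V} {i : ν} {e : ν → ℂ} {t : V}
    (h : Fintype.linearCombination ℂ w e t = w i t) (F : AddMonoidAlgebra ℤ (ν → ℂ)) :
    evalAt (substMonomials w (substMonomials (Function.update varExp i e) F)) t =
      evalAt (substMonomials w F) t := by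
  refine evalAt_substMonomials_substMonomials (fun j => ?_) F
  rcases eq_or_ne j i with rfl | hj
  · rw [Function.update_self, h]
  · rw [Function.update_of_ne hj, linearCombination_varExp]

theorem evalAt_substMonomials_extend [DecidableEq ν] [DecidableEq ν'] {w : ν ⊕ ν' → Dual ℂ V}
    {r : κ → ν} {e : κ → ν ⊕ ν' → ℂ} {t : V}
    (h : ∀ i, Fintype.linearCombination ℂ w (e i) t = w (Sum.inl (r i)) t)
    (F : AddMonoidAlgebra ℤ (ν ⊕ ν' → ℂ)) :
    evalAt (substMonomials w (substMonomials
      (Sum.elim (Function.extend r e fun j => varExp (Sum.inl j))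
        fun j => varExp (Sum.inr j)) F)) t =
      evalAt (substMonomials w F) t := by
  classical
  refine evalAt_substMonomials_substMonomials (Sum.rec (fun j => ?_) fun j => ?_) F
  · by_cases hj : ∃ i, r i = j
    · rw [Sum.elim_inl, Function.extend_def, dif_pos hj, h, hj.choose_spec]
    · rw [Sum.elim_inl, Function.extend_apply' _ _ _ hj, linearCombination_varExp]
  · rw [Sum.elim_inr, linearCombination_varExp]

theorem evalAt_substMonomials_extend_zsmul [DecidableEq ν] [DecidableEq ν'] {ε : ν → Dual ℂ V}
    {δ : ν' → Dual ℂ V} {r : κ → ν} {s : κ → ν'} {a b : κ → ℤ} (ha : ∀ i, IsUnit (a i)) {t : V}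
    (h : ∀ i, (a i • ε (r i) - b i • δ (s i)) t = 0) (F : AddMonoidAlgebra ℤ (ν ⊕ ν' → ℂ)) :
    evalAt (substMonomials (Sum.elim ε δ) (substMonomials
      (Sum.elim (Function.extend r (fun i => (a i * b i) • varExp (Sum.inr (s i)))
        fun j => varExp (Sum.inl j)) fun j => varExp (Sum.inr j)) F)) t =
      evalAt (substMonomials (Sum.elim ε δ) F) t := by
  refine evalAt_substMonomials_extend (fun i => ?_) F
  have h0 : a i • ε (r i) t = b i • δ (s i) t := sub_eq_zero.1 (h i)
  rw [map_zsmul, linearCombination_varExp, Sum.elim_inl, Sum.elim_inr, LinearMap.smul_apply,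
    mul_smul, ← h0, smul_smul, Int.isUnit_mul_self (ha i), one_smul]

end Substitutions

theorem mainTheorem2_general {L : Type u} [AddCommGroup L] [Module ℂ L] [LieSuperalgebra L]
    (H : EvenAbelian L) {ι : Type*} [Fintype ι] {β : ι → H.Weight} (hβ : Function.Injective β)
    {xβ : ι → L} (hxβ : ∀ i, xβ i ∈ rootSpace H (β i)) (hxβ0 : ∀ i, xβ i ≠ 0)
    (x : OddPart L) (hx : (x : L) = ∑ i, xβ i) (hxx : bracket (x : L) (x : L) = 0) :
    (∃! ds : superCharRing.{u, v} H →+* superCharRing.{u, v} (H.ds x), IsDS H x ds) ∧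
    ∀ ds : superCharRing.{u, v} H →+* superCharRing.{u, v} (H.ds x), IsDS H x ds →
    ∀ f : superCharRing.{u, v} H,
    (∀ (K : Submodule ℂ L) (hK : IsEmbeddedDS x K),
      pullbackExp (embeddedToHx H hK) (ds f).1 =
        pullbackExp (K.comap H.carrier.subtype).subtype f.1 ∧
      ∀ t : ↥(K.comap H.carrier.subtype),
        evalAt (ds f).1 (embeddedToHx H hK t) = evalAt f.1 (t : H.carrier)) ∧
    (∀ (p q : ℕ) (ε : Fin (p + 1) → H.Weight) (δ : Fin (q + 1) → H.Weight),
      Set.range β = {ε 0 - δ 0} →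
      ∀ F, substMonomials (Sum.elim ε δ) F = f.1 → ∀ t : hCent H x,
        evalAt (ds f).1 (toHx H x t) =
          evalAt (substMonomials (Sum.elim ε δ)
            (substMonomials (Function.update varExp (Sum.inl 0) (varExp (Sum.inr 0))) F))
            (t : H.carrier)) ∧
    (∀ (ε : Fin 3 → H.Weight) (δ : Fin 1 → H.Weight),
      Set.range β = {(1 / 2 : ℂ) • (ε 0 + ε 1 + ε 2 - δ 0)} →
      ∀ F, substMonomials
          (Sum.elim (fun i => (1 / 2 : ℂ) • ε i) (fun j => (1 / 2 : ℂ) • δ j)) F = f.1 →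
      ∀ t : hCent H x,
        evalAt (ds f).1 (toHx H x t) =
          evalAt (substMonomials
            (Sum.elim (fun i => (1 / 2 : ℂ) • ε i) (fun j => (1 / 2 : ℂ) • δ j))
            (substMonomials (Function.update varExp (Sum.inr 0)
              (varExp (Sum.inl 0) + varExp (Sum.inl 1) + varExp (Sum.inl 2))) F))
            (t : H.carrier)) ∧
    (∀ ε : Fin 3 → H.Weight, Set.range β = {ε 0 - ε 1 - ε 2} →
      ∀ F, substMonomials ε F = f.1 → ∀ t : hCent H x,
        evalAt (ds f).1 (toHx H x t) =
          evalAt (substMonomials ε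
            (substMonomials (Function.update varExp 0 (varExp 1 + varExp 2)) F)) (t : H.carrier)) ∧
    (∀ (p q : ℕ) (ε : Fin p → H.Weight) (δ : Fin q → H.Weight)
      (r : ι → Fin p) (s : ι → Fin q) (a b : ι → ℤ),
      (∀ i, (a i = 1 ∨ a i = -1) ∧ (b i = 1 ∨ b i = -1)) →
      (∀ i, β i = a i • ε (r i) - b i • δ (s i)) →
      ∀ F, substMonomials (Sum.elim ε δ) F = f.1 → ∀ t : hCent H x,
        evalAt (ds f).1 (toHx H x t) =
          evalAt (substMonomials (Sum.elim ε δ)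
            (substMonomials (Sum.elim
              (Function.extend r (fun i => (a i * b i) • varExp (Sum.inr (s i)))
                (fun j => varExp (Sum.inl j)))
              (fun j => varExp (Sum.inr j))) F))
            (t : H.carrier)) ∧
    ((∀ t : H.carrier, t ∈ hCent H x ↔ ∀ i, β i t = 0) ∧
      pullbackExp (toHx H x) (ds f).1 = pullbackExp (hCent H x).subtype f.1 ∧
      ∀ t : hCent H x, evalAt (ds f).1 (toHx H x t) = evalAt f.1 (t : H.carrier)) := by
  have hcent (t : H.carrier) : t ∈ hCent H x ↔ ∀ i, β i t = 0 := mem_hCent_iff hβ hxβ hxβ0 hx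
  have hroot {μ : H.Weight} (hμ : Set.range β = {μ}) (t : hCent H x) : μ t = 0 := by
    obtain ⟨i, rfl⟩ : μ ∈ Set.range β := hμ ▸ rfl
    exact (hcent t).1 t.2 i
  refine ⟨existsUnique_isDS hxx, fun ds hds f => ⟨fun K hK =>
    ⟨hds.pullbackExp_embeddedToHx hxx hK f, fun t => hds.evalAt_toHx hxx f _⟩,
    fun p q ε δ hB F hF t => ?_, fun ε δ hB F hF t => ?_, fun ε hB F hF t => ?_,
    fun p q ε δ r s a b hab hB F hF t => ?_, hcent, hds.pullbackExp_toHx hxx f,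
    hds.evalAt_toHx hxx f⟩⟩ <;> rw [hds.evalAt_toHx hxx, ← hF]
  · have h0 : ε 0 t - δ 0 t = 0 := hroot hB t
    refine (evalAt_substMonomials_update ?_ F).symm
    rw [linearCombination_varExp]
    exact (sub_eq_zero.1 h0).symm
  · have h0 : 1 / 2 * (ε 0 t + ε 1 t + ε 2 t - δ 0 t) = 0 := hroot hB t
    refine (evalAt_substMonomials_update ?_ F).symm
    simp only [map_add, linearCombination_varExp, Sum.elim_inl, Sum.elim_inr, LinearMap.add_apply,
      LinearMap.smul_apply, smul_eq_mul]
    linear_combination h0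
  · have h0 : ε 0 t - ε 1 t - ε 2 t = 0 := hroot hB t
    refine (evalAt_substMonomials_update ?_ F).symm
    rw [map_add, linearCombination_varExp, linearCombination_varExp, LinearMap.add_apply]
    linear_combination -h0
  · exact (evalAt_substMonomials_extend_zsmul (fun i => Int.isUnit_iff.2 (hab i).1)
      (fun i => hB i ▸ (hcent t).1 t.2 i) F).symm

end SuperLie

theorem mainTheorem2 {L : Type u} [AddCommGroup L] [Module ℂ L] [FiniteDimensional ℂ L]
    [LieSuperalgebra L] (H : EvenAbelian L) (hH : H.IsCartan) (hL : IsContragredientOrGL H)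
    (Φ : InvariantForm L) {k : ℕ} (β : Fin k → H.Weight) (hβ : IsIsotropicSet Φ H β)
    (xβ : Fin k → L) (hxβ : ∀ i, xβ i ∈ rootSpace H (β i)) (hxβ0 : ∀ i, xβ i ≠ 0)
    (x : OddPart L) (hx : (x : L) = ∑ i, xβ i) :
    LieSuperalgebra.bracket (x : L) (x : L) = 0 ∧
    (∃! ds : superCharRing.{u, v} H →+* superCharRing.{u, v} (H.ds x), IsDS H x ds) ∧
    ∀ ds : superCharRing.{u, v} H →+* superCharRing.{u, v} (H.ds x), IsDS H x ds →
    ∀ f : superCharRing.{u, v} H,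
    -- (1) restriction to `h_x`, for every embedding of `g_x` into `g^x`
    (∀ (K : Submodule ℂ L) (hK : IsEmbeddedDS x K),
      pullbackExp (embeddedToHx H hK) (ds f).1 = pullbackExp (K.comap H.carrier.subtype).subtype f.1 ∧
      ∀ t : ↥(K.comap H.carrier.subtype),
        evalAt (ds f).1 (embeddedToHx H hK t) = evalAt f.1 (t : H.carrier)) ∧
    -- (2) a single root
    (∀ (p q : ℕ) (ε : Fin (p + 1) → H.Weight) (δ : Fin (q + 1) → H.Weight),
      Set.range β = {ε 0 - δ 0} →
      ∀ F, substMonomials (Sum.elim ε δ) F = f.1 → ∀ t : hCent H x,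
        evalAt (ds f).1 (toHx H x t) =
          evalAt (substMonomials (Sum.elim ε δ)
            (substMonomials (Function.update varExp (Sum.inl 0) (varExp (Sum.inr 0))) F))
            (t : H.carrier)) ∧
    (∀ (ε : Fin 3 → H.Weight) (δ : Fin 1 → H.Weight),
      Set.range β = {(1 / 2 : ℂ) • (ε 0 + ε 1 + ε 2 - δ 0)} →
      ∀ F, substMonomials
          (Sum.elim (fun i => (1 / 2 : ℂ) • ε i) (fun j => (1 / 2 : ℂ) • δ j)) F = f.1 →
      ∀ t : hCent H x,
        evalAt (ds f).1 (toHx H x t) =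
          evalAt (substMonomials
            (Sum.elim (fun i => (1 / 2 : ℂ) • ε i) (fun j => (1 / 2 : ℂ) • δ j))
            (substMonomials (Function.update varExp (Sum.inr 0)
              (varExp (Sum.inl 0) + varExp (Sum.inl 1) + varExp (Sum.inl 2))) F))
            (t : H.carrier)) ∧
    (∀ ε : Fin 3 → H.Weight, Set.range β = {ε 0 - ε 1 - ε 2} →
      ∀ F, substMonomials ε F = f.1 → ∀ t : hCent H x,
        evalAt (ds f).1 (toHx H x t) =
          evalAt (substMonomials ε
            (substMonomials (Function.update varExp 0 (varExp 1 + varExp 2)) F)) (t : H.carrier)) ∧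
    -- (3) several roots `a_i ε_(r i) - b_i δ_(s i)`
    (∀ (p q : ℕ) (ε : Fin p → H.Weight) (δ : Fin q → H.Weight)
      (r : Fin k → Fin p) (s : Fin k → Fin q) (a b : Fin k → ℤ),
      (∀ i, (a i = 1 ∨ a i = -1) ∧ (b i = 1 ∨ b i = -1)) →
      (∀ i, β i = a i • ε (r i) - b i • δ (s i)) →
      ∀ F, substMonomials (Sum.elim ε δ) F = f.1 → ∀ t : hCent H x,
        evalAt (ds f).1 (toHx H x t) =
          evalAt (substMonomials (Sum.elim ε δ)
            (substMonomials (Sum.elim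
              (Function.extend r (fun i => (a i * b i) • varExp (Sum.inr (s i)))
                (fun j => varExp (Sum.inl j)))
              (fun j => varExp (Sum.inr j))) F))
            (t : H.carrier)) ∧
    -- (4) restriction to the common zero space of `β_1, …, β_k`, which is `h^x`
    ((∀ t : H.carrier, t ∈ hCent H x ↔ ∀ i, β i t = 0) ∧
      pullbackExp (toHx H x) (ds f).1 = pullbackExp (hCent H x).subtype f.1 ∧
      ∀ t : hCent H x, evalAt (ds f).1 (toHx H x t) = evalAt f.1 (t : H.carrier)) := by
  have hxx : LieSuperalgebra.bracket (x : L) (x : L) = 0 :=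
    hx ▸ hβ.bracket_sum_self_eq_zero hH hL hxβ
  have hinj : Function.Injective β := fun i j h => by_contra fun hij => (hβ.ne i j hij).1 h
  exact ⟨hxx, mainTheorem2_general H hinj hxβ hxβ0 x hx hxx⟩
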